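/- Let $T$ be an automorphism of a standard Borel probability space $(X,\mathcal B,\mu)$ (an invertible, up to null sets, measure-preserving map). Assume that $T$ is totally ergodic, i.e. $T^m$ is ergodic for every $m\neq 0$, and that it has Asymptotical Orthogonal Powers (AOP): for all $f,g\in L^2(\mu)$ with $\int_X f\,d\mu=\int_X g\,d\mu=0$, \[ \lim_{\substack{r,s\to\infty\\ r,s \text{ different primes}}}\ \sup_{\kappa}\left|\int_{X\times X} f(x)g(x')\,d\kappa(x,x')\right|=0, \] where $\kappa$ runs over the ergodic joinings of $T^r$ and $T^s$, i.e. the probability measures on $X\times X$ with both marginals equal to $\mu$ that are invariant and ergodic under $T^r\times T^s$. Let $S$ be a uniquely ergodic continuous map of a compact metric space $Y$, let $\nu$ be the unique $S$-invariant Borel probability measure on $Y$, and assume that the measure-theoretic systems $(X,\mu,T)$ and $(Y,\nu,S)$ are isomorphic. Then for every multiplicative function $u:\{1,2,\dots\}\to\mathbb C$ (that is, $u(1)=1$ and $u(mn)=u(m)u(n)$ for coprime $m,n$) with $|u|\le 1$, every continuous $f:Y\to\mathbb C$ with $\int_Y f\,d\nu=0$ and every $y\in Y$, \[ \lim_{N\to\infty}\frac1N\sum_{1\le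 n\le N} f(S^n y)\,u(n)=0 . \] In particular, the assertion of Sarnak's conjecture holds for $S$: for every continuous $f:Y\to\mathbb C$ (of arbitrary mean) and every $y\in Y$, \[ \lim_{N\to\infty}\frac1N\sum_{1\le n\le N} f(S^n y)\,\mu_{\mathrm{Möb}}(n)=0, \] where $\mu_{\mathrm{Möb}}$ is the Möbius function. -/

import Mathlib

open MeasureTheory Filter Topology
open scoped ENNReal

/-- `φ` is an invertible measure-preserving map `(X, μ) → (Y, ν)` in the sense of ergodic theory,
i.e. up to null sets. -/
def IsInvertibleMod0 {X Y : Type*} [MeasurableSpace X] [MeasurableSpace Y]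
    (φ : X → Y) (μ : Measure X) (ν : Measure Y) : Prop :=
  MeasurePreserving φ μ ν ∧
    ∃ ψ : Y → X, MeasurePreserving ψ ν μ ∧ (∀ᵐ x ∂μ, ψ (φ x) = x) ∧ (∀ᵐ y ∂ν, φ (ψ y) = y)

/-- `T` is an automorphism of `(X, μ)` (invertibility is understood mod null sets). -/
def IsAutomorphism {X : Type*} [MeasurableSpace X] (T : X → X) (μ : Measure X) : Prop :=
  IsInvertibleMod0 T μ μ

/-- All nonzero powers of `T` are ergodic. (For an automorphism, `T ^ (-m)` is ergodic if and only
if `T ^ m` is, so positive powers suffice.) -/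
def IsTotallyErgodic {X : Type*} [MeasurableSpace X] (T : X → X) (μ : Measure X) : Prop :=
  ∀ m : ℕ, 0 < m → Ergodic T^[m] μ

/-- The measure-theoretic systems `(X, μ, T)` and `(Y, ν, S)` are isomorphic. -/
def AreIsomorphic {X Y : Type*} [MeasurableSpace X] [MeasurableSpace Y]
    (T : X → X) (μ : Measure X) (S : Y → Y) (ν : Measure Y) : Prop :=
  ∃ φ : X → Y, IsInvertibleMod0 φ μ ν ∧ ∀ᵐ x ∂μ, φ (T x) = S (φ x)

/-- The ergodic joinings of `(X, μ, T₁)` and `(X, μ, T₂)`: the measures on `X × X` with both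
marginals `μ` that are invariant and ergodic under `T₁ × T₂`. -/
def ergodicJoinings {X : Type*} [MeasurableSpace X] (T₁ T₂ : X → X) (μ : Measure X) :
    Set (Measure (X × X)) :=
  {κ | κ.map Prod.fst = μ ∧ κ.map Prod.snd = μ ∧ Ergodic (Prod.map T₁ T₂) κ}

/-- The pairs of different primes `(r, s)`, with `r, s → ∞`. -/
def differentPrimesAtTop : Filter (ℕ × ℕ) :=
  (atTop ×ˢ atTop) ⊓ 𝓟 {p : ℕ × ℕ | p.1.Prime ∧ p.2.Prime ∧ p.1 ≠ p.2}

/-- Asymptotical Orthogonal Powers. The supremum is taken in `[0, ∞]`. -/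
def HasAOP {X : Type*} [MeasurableSpace X] (T : X → X) (μ : Measure X) : Prop :=
  ∀ f g : X → ℂ, MemLp f 2 μ → MemLp g 2 μ → ∫ x, f x ∂μ = 0 → ∫ x, g x ∂μ = 0 →
    Tendsto
      (fun p : ℕ × ℕ => ⨆ κ ∈ ergodicJoinings T^[p.1] T^[p.2] μ,
        ‖∫ z : X × X, f z.1 * g z.2 ∂κ‖ₑ)
      differentPrimesAtTop (𝓝 0)

/-- `ν` is the unique `S`-invariant Borel probability measure. -/
def IsUniquelyErgodic {Y : Type*} [MeasurableSpace Y] (S : Y → Y) (ν : Measure Y) : Prop :=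
  IsProbabilityMeasure ν ∧ MeasurePreserving S ν ν ∧
    ∀ ν' : Measure Y, IsProbabilityMeasure ν' → MeasurePreserving S ν' ν' → ν' = ν

/-- The conclusion of Sarnak's conjecture for `S`: every sequence `f (S ^ n y)` with `f` continuous
is asymptotically orthogonal to the Möbius function. -/
def IsMoebiusDisjoint {Y : Type*} [TopologicalSpace Y] (S : Y → Y) : Prop :=
  ∀ (f : C(Y, ℂ)) (y : Y),
    Tendsto
      (fun N : ℕ => (1 / (N : ℂ)) *
        ∑ n ∈ Finset.Icc 1 N, f (S^[n] y) * ((ArithmeticFunction.moebius n : ℤ) : ℂ))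
      atTop (𝓝 0)

/-!
By the Kátai–Bourgain–Sarnak–Ziegler criterion it suffices that the correlations
`(1/M) ∑ f(S^{rm} y) conj f(S^{sm} y)` become small as the distinct primes `r, s` grow. The
criterion rests on the Turán–Kubilius inequality: counting each `n` with its number of prime
divisors in a long range replaces `∑ f(S^n y) u(n)` by a sum over `n = pm`, where
`u(pm) = u(p) u(m)` up to a negligible error, and Cauchy–Schwarz on dyadic blocks of `p` removes
`u`.

The correlations are integrals of `f ⊗ conj f` against empirical measures of an `S^r × S^s`-orbit.
Their limit points are invariant, and among the invariant measures the real part of such an integral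
is maximal at an extreme point, i.e. at an ergodic measure. Powers of a totally ergodic uniquely
ergodic map are uniquely ergodic, so both marginals of that measure are `ν`: it is an ergodic
joining of `S^r` and `S^s`, to which AOP applies since AOP passes through isomorphisms.

For the Möbius function and `f` of arbitrary mean one also needs `∑_{n ≤ N} μ(n) = o(N)`, which is
the Ingham–Karamata Tauberian theorem for the Laplace transform `1 / ((s + 1) ζ(s + 1))`, continuous
up to `re s = 0` because `ζ` has no zeros on `re s = 1`.
-/

section Tauberian

open FourierTransform

/-- Slow oscillation at `+∞`, the Tauberian condition of the Ingham–Karamata theorem. -/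
def SlowlyOscillating (h : ℝ → ℂ) : Prop :=
  ∀ ε > 0, ∃ δ > 0, ∀ᶠ t in atTop, ∀ u, |u - t| ≤ δ → ‖h u - h t‖ ≤ ε

theorem fourier_mul_exp_neg (h : ℝ → ℂ) (σ v : ℝ) :
    𝓕 (fun t => h t * Complex.exp (-(σ * t))) v =
      ∫ t : ℝ, h t * Complex.exp (-((σ + 2 * Real.pi * Complex.I * v) * t)) := by
  rw [Real.fourier_real_eq_integral_exp_smul]
  congr 1 with t
  rw [smul_eq_mul, mul_left_comm, ← Complex.exp_add]
  congr 2
  push_cast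
  ring

theorem integral_fourier_mul_comp_add {f k : ℝ → ℂ} (hf : Integrable f) (hk : Integrable k)
    (τ : ℝ) :
    ∫ u, 𝓕 f u * k (τ + u) =
      ∫ v : ℝ, f v * (Complex.exp (2 * Real.pi * Complex.I * τ * v) * 𝓕 k v) := by
  have hflip : (innerₗ ℝ : ℝ →ₗ[ℝ] ℝ →ₗ[ℝ] ℝ).flip = innerₗ ℝ := by ext; simp
  have parseval := VectorFourier.integral_fourierIntegral_smul_eq_flip (L := innerₗ ℝ)
    Real.continuous_fourierChar (by simpa using! continuous_inner) hf (hk.comp_add_left τ)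
  rw [hflip] at parseval
  refine parseval.trans ?_
  congr 1 with v
  rw [smul_eq_mul]
  congr 1
  have htranslate := congrFun
    (VectorFourier.fourierIntegral_comp_add_right Real.fourierChar volume (innerₗ ℝ) k τ) v
  simp only [Function.comp_def, add_comm _ τ] at htranslate
  rw [htranslate, Circle.smul_def, Real.fourierChar_apply, smul_eq_mul]
  congr 2
  simp
  ring

section LaplaceTransform

variable {h : ℝ → ℂ} {g : ℂ → ℂ} {M : ℝ}

theorem norm_mul_exp_neg_le (hM : ∀ t, ‖h t‖ ≤ M) (h0 : ∀ t < 0, h t = 0) (s : ℂ) (t : ℝ) :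
    ‖h t * Complex.exp (-(s * t))‖ ≤
      Set.indicator (Set.Ici 0) (fun t => M * Real.exp (-s.re * t)) t := by
  rcases lt_or_ge t 0 with ht | ht
  · simp [h0 t ht, ht]
  · rw [Set.indicator_of_mem (Set.mem_Ici.2 ht), norm_mul, Complex.norm_exp]
    simpa using mul_le_mul_of_nonneg_right (hM t) (Real.exp_pos (-(s.re * t))).le

theorem integrable_mul_exp_neg (hm : Measurable h) (hM : ∀ t, ‖h t‖ ≤ M)
    (h0 : ∀ t < 0, h t = 0) {s : ℂ} (hs : 0 < s.re) :
    Integrable (fun t : ℝ => h t * Complex.exp (-(s * t))) := by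
  refine Integrable.mono' ?_ (by fun_prop) (.of_forall (norm_mul_exp_neg_le hM h0 s))
  rw [integrable_indicator_iff measurableSet_Ici, integrableOn_Ici_iff_integrableOn_Ioi]
  exact (exp_neg_integrableOn_Ioi 0 hs).const_mul M

theorem tendsto_integral_fourier_mul_exp_neg (hm : Measurable h) (hM : ∀ t, ‖h t‖ ≤ M)
    (h0 : ∀ t < 0, h t = 0) (φ : SchwartzMap ℝ ℂ) (τ : ℝ) :
    Tendsto (fun σ : ℝ => ∫ u : ℝ, 𝓕 φ u * (h (τ + u) * Complex.exp (-(σ * ↑(τ + u)))))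
      (𝓝[>] 0) (𝓝 (∫ u : ℝ, 𝓕 φ u * h (τ + u))) := by
  refine tendsto_integral_filter_of_dominated_convergence (fun u => ‖𝓕 φ u‖ * M)
    (.of_forall fun σ => ?_) ?_ ((SchwartzMap.integrable _).norm.mul_const M)
    (.of_forall fun u => ?_)
  · exact (SchwartzMap.continuous _).aestronglyMeasurable.mul (by fun_prop)
  · filter_upwards [self_mem_nhdsWithin] with σ hσ
    refine .of_forall fun u => ?_
    rw [norm_mul]
    gcongr
    refine (norm_mul_exp_neg_le hM h0 σ (τ + u)).trans
      (Set.indicator_apply_le' (fun (hu : 0 ≤ τ + u) => ?_)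
        fun _ => (norm_nonneg _).trans (hM 0))
    refine mul_le_of_le_one_right ((norm_nonneg _).trans (hM 0)) (Real.exp_le_one_iff.2 ?_)
    exact mul_nonpos_of_nonpos_of_nonneg (neg_nonpos.2 (le_of_lt hσ)) hu
  · have hcont : Continuous fun σ : ℝ =>
      𝓕 φ u * (h (τ + u) * Complex.exp (-(σ * ↑(τ + u)))) := by fun_prop
    simpa using (hcont.tendsto 0).mono_left nhdsWithin_le_nhds

theorem tendsto_integral_mul_exp_mul_boundary (hg : ContinuousOn g {s | 0 ≤ s.re})
    {φ : ℝ → ℂ} (hφ : Continuous φ) (hφc : HasCompactSupport φ) (τ : ℝ) :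
    Tendsto (fun σ : ℝ => ∫ v : ℝ, φ v *
        (Complex.exp (2 * Real.pi * Complex.I * τ * v) * g (σ + 2 * Real.pi * Complex.I * v)))
      (𝓝[>] 0) (𝓝 (∫ v : ℝ, φ v *
        (Complex.exp (2 * Real.pi * Complex.I * τ * v) * g (2 * Real.pi * Complex.I * v)))) := by
  have hline : ContinuousOn (fun p : ℝ × ℝ => g (p.1 + 2 * Real.pi * Complex.I * p.2))
      (Set.Ici 0 ×ˢ Set.univ) :=
    hg.comp (by fun_prop) fun p hp => by simpa using hp.1
  have hcont := continuousOn_integral_of_compact_support (μ := volume) (s := Set.Ici (0 : ℝ)) hφc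
    (f := fun σ v : ℝ => φ v * (Complex.exp (2 * Real.pi * Complex.I * τ * v) *
      g (σ + 2 * Real.pi * Complex.I * v)))
    (.mul (by fun_prop) (.mul (by fun_prop) hline))
    fun σ v _ hv => by simp [image_eq_zero_of_notMem_tsupport hv]
  simpa using (hcont 0 Set.self_mem_Ici).mono_left (nhdsWithin_mono _ Set.Ioi_subset_Ici_self)

theorem integral_fourier_mul_eq_boundary (hm : Measurable h) (hM : ∀ t, ‖h t‖ ≤ M)
    (h0 : ∀ t < 0, h t = 0) (hg : ContinuousOn g {s | 0 ≤ s.re})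
    (hgh : ∀ s : ℂ, 0 < s.re → ∫ t : ℝ, h t * Complex.exp (-(s * t)) = g s)
    (φ : SchwartzMap ℝ ℂ) (hφ : HasCompactSupport φ) (τ : ℝ) :
    ∫ u : ℝ, 𝓕 φ u * h (τ + u) =
      ∫ v : ℝ, φ v *
        (Complex.exp (2 * Real.pi * Complex.I * τ * v) * g (2 * Real.pi * Complex.I * v)) := by
  refine tendsto_nhds_unique (tendsto_integral_fourier_mul_exp_neg hm hM h0 φ τ)
    ((tendsto_integral_mul_exp_mul_boundary hg φ.continuous hφ τ).congr' ?_)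
  filter_upwards [self_mem_nhdsWithin] with σ (hσ : 0 < σ)
  rw [SchwartzMap.fourier_coe, integral_fourier_mul_comp_add φ.integrable
    (integrable_mul_exp_neg hm hM h0 (s := σ) (by simpa using hσ))]
  simp_rw [fourier_mul_exp_neg]
  congr 1 with v
  rw [hgh _ (by simpa using hσ)]

theorem tendsto_integral_fourier_mul_comp_add (hm : Measurable h) (hM : ∀ t, ‖h t‖ ≤ M)
    (h0 : ∀ t < 0, h t = 0) (hg : ContinuousOn g {s | 0 ≤ s.re})
    (hgh : ∀ s : ℂ, 0 < s.re → ∫ t : ℝ, h t * Complex.exp (-(s * t)) = g s)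
    (φ : SchwartzMap ℝ ℂ) (hφ : HasCompactSupport φ) :
    Tendsto (fun τ => ∫ u : ℝ, 𝓕 φ u * h (τ + u)) atTop (𝓝 0) := by
  have riemannLebesgue := (Real.tendsto_integral_exp_smul_cocompact
    (fun v : ℝ => φ v * g (2 * Real.pi * Complex.I * v))).comp
    (tendsto_neg_atTop_atBot.mono_right atBot_le_cocompact)
  refine riemannLebesgue.congr fun τ => ?_
  rw [integral_fourier_mul_eq_boundary hm hM h0 hg hgh φ hφ]
  refine integral_congr_ae (.of_forall fun v => ?_)
  simp only [Circle.smul_def, Real.fourierChar_apply, smul_eq_mul]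
  rw [show ((2 * Real.pi * -(v * -τ) : ℝ) : ℂ) * Complex.I =
    2 * Real.pi * Complex.I * τ * v by push_cast; ring]
  ring

theorem tendsto_integral_fourier_mul_comp_add_div (hm : Measurable h) (hM : ∀ t, ‖h t‖ ≤ M)
    (h0 : ∀ t < 0, h t = 0) (hg : ContinuousOn g {s | 0 ≤ s.re})
    (hgh : ∀ s : ℂ, 0 < s.re → ∫ t : ℝ, h t * Complex.exp (-(s * t)) = g s)
    (φ : SchwartzMap ℝ ℂ) (hφ : HasCompactSupport φ) {c : ℝ} (hc : 0 < c) :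
    Tendsto (fun τ => ∫ u : ℝ, 𝓕 φ u * h (τ + u / c)) atTop (𝓝 0) := by
  have hlaplace : ∀ s : ℂ, 0 < s.re →
      ∫ t : ℝ, h (t / c) * Complex.exp (-(s * t)) = c * g (c * s) := by
    intro s hs
    rw [← hgh _ (by simpa using mul_pos hc hs)]
    have := Measure.integral_comp_div (fun t : ℝ => h t * Complex.exp (-(c * s * t))) c
    rw [abs_of_pos hc, Complex.real_smul] at this
    rw [← this]
    congr 1 with t
    have : (c : ℂ) ≠ 0 := by exact_mod_cast hc.ne'
    push_cast
    field_simp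
  have hgc : ContinuousOn (fun s => c * g (c * s)) {s | 0 ≤ s.re} :=
    .mul (by fun_prop) (hg.comp (by fun_prop) fun s hs => by simpa using mul_nonneg hc.le hs)
  have := (tendsto_integral_fourier_mul_comp_add (h := fun t => h (t / c)) (by fun_prop)
    (fun t => hM _) (fun t ht => h0 _ (div_neg_of_neg_of_pos ht hc)) hgc hlaplace φ hφ).comp
    (tendsto_id.const_mul_atTop hc)
  refine this.congr fun τ => ?_
  simp only [Function.comp_apply, id, add_div, mul_div_cancel_left₀ _ hc.ne']

end LaplaceTransform

theorem SlowlyOscillating.eventually_norm_sub_le {h : ℝ → ℂ} {M : ℝ} (hh : SlowlyOscillating h)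
    (hM : ∀ t, ‖h t‖ ≤ M) {ε : ℝ} (hε : 0 < ε) :
    ∃ C, 0 ≤ C ∧ ∀ᶠ t in atTop, ∀ u, ‖h t - h u‖ ≤ ε + C * |u - t| := by
  obtain ⟨δ, hδ, hev⟩ := hh ε hε
  have hM0 : 0 ≤ M := (norm_nonneg _).trans (hM 0)
  refine ⟨2 * M / δ, by positivity, hev.mono fun t ht u => ?_⟩
  rcases le_total |u - t| δ with hu | hu
  · rw [norm_sub_rev]
    exact (ht u hu).trans (le_add_of_nonneg_right (by positivity))
  · calc ‖h t - h u‖ ≤ 2 * M := by linarith [norm_sub_le (h t) (h u), hM t, hM u]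
      _ = 2 * M / δ * δ := by field_simp
      _ ≤ ε + 2 * M / δ * |u - t| :=
        (by gcongr : 2 * M / δ * δ ≤ 2 * M / δ * |u - t|).trans (le_add_of_nonneg_left hε.le)

theorem norm_le_norm_integral_mul_comp_add_div {h K : ℝ → ℂ} {M ε C c τ : ℝ} (hm : Measurable h)
    (hM : ∀ t, ‖h t‖ ≤ M) (hK : Integrable K) (hK1 : ∫ u, K u = 1)
    (hKm : Integrable fun u => |u| * ‖K u‖) (hc : 0 < c)
    (hτ : ∀ u, ‖h τ - h u‖ ≤ ε + C * |u - τ|) :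
    ‖h τ‖ ≤ ‖∫ u, K u * h (τ + u / c)‖ + (ε * ∫ u, ‖K u‖) + C / c * ∫ u, |u| * ‖K u‖ := by
  have hKh : Integrable fun u => K u * h (τ + u / c) :=
    hK.mul_bdd (c := M) (hm.comp (by fun_prop)).aestronglyMeasurable (.of_forall fun _ => hM _)
  have hdiff : h τ - ∫ u, K u * h (τ + u / c) = ∫ u, K u * (h τ - h (τ + u / c)) := by
    simp_rw [mul_sub]
    rw [integral_sub (hK.mul_const _) hKh, integral_mul_const, hK1, one_mul]
  have herror : ‖h τ - ∫ u, K u * h (τ + u / c)‖ ≤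
      (ε * ∫ u, ‖K u‖) + C / c * ∫ u, |u| * ‖K u‖ := by
    rw [hdiff, ← integral_const_mul, ← integral_const_mul,
      ← integral_add (hK.norm.const_mul _) (hKm.const_mul _)]
    refine norm_integral_le_of_norm_le ((hK.norm.const_mul _).add (hKm.const_mul _))
      (.of_forall fun u => ?_)
    calc ‖K u * (h τ - h (τ + u / c))‖ ≤ ‖K u‖ * (ε + C * |τ + u / c - τ|) := by
          rw [norm_mul]; gcongr; exact hτ _
      _ = ε * ‖K u‖ + C / c * (|u| * ‖K u‖) := by
          rw [add_sub_cancel_left, abs_div, abs_of_pos hc]; ring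
  rw [add_assoc]
  exact (norm_le_norm_add_norm_sub' _ _).trans (by gcongr)

theorem exists_schwartz_hasCompactSupport_integral_fourier_eq_one :
    ∃ φ : SchwartzMap ℝ ℂ, HasCompactSupport φ ∧ ∫ u, 𝓕 φ u = 1 := by
  let b : ContDiffBump (0 : ℝ) := ⟨1, 2, one_pos, one_lt_two⟩
  have hb : HasCompactSupport (fun x => ((b x : ℝ) : ℂ)) :=
    b.hasCompactSupport.comp_left Complex.ofReal_zero
  have hb' : ContDiff ℝ (⊤ : ℕ∞) (fun x => ((b x : ℝ) : ℂ)) :=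
    Complex.ofRealCLM.contDiff.comp b.contDiff
  refine ⟨hb.toSchwartzMap hb', hb, ?_⟩
  set φ := hb.toSchwartzMap hb'
  have inversion := congrFun (φ.continuous.fourierInv_fourier_eq φ.integrable
    (by rw [← SchwartzMap.fourier_coe]; exact SchwartzMap.integrable _)) 0
  rw [← SchwartzMap.fourier_coe, Real.fourierInv_eq] at inversion
  have hφ0 : φ 0 = 1 := by
    change ((b 0 : ℝ) : ℂ) = 1
    rw [b.one_of_mem_closedBall (by simp [b]), Complex.ofReal_one]
  simpa [hφ0] using inversion

-- By Riemann–Lebesgue, averages of `h` against the fixed kernel `𝓕 φ` vanish at infinity: `φ` cuts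
-- off a compact piece of the boundary line. Narrow kernels and slow oscillation then give `h → 0`.
theorem SlowlyOscillating.tendsto_zero_of_laplace {h : ℝ → ℂ} {g : ℂ → ℂ} {M : ℝ}
    (hh : SlowlyOscillating h) (hm : Measurable h) (hM : ∀ t, ‖h t‖ ≤ M)
    (h0 : ∀ t < 0, h t = 0) (hg : ContinuousOn g {s | 0 ≤ s.re})
    (hgh : ∀ s : ℂ, 0 < s.re → ∫ t : ℝ, h t * Complex.exp (-(s * t)) = g s) :
    Tendsto h atTop (𝓝 0) := by
  obtain ⟨φ, hφ, hφ1⟩ := exists_schwartz_hasCompactSupport_integral_fourier_eq_one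
  have hK : Integrable (𝓕 φ : SchwartzMap ℝ ℂ) := SchwartzMap.integrable _
  have hKm : Integrable fun u => |u| * ‖𝓕 φ u‖ := by
    simpa using SchwartzMap.integrable_pow_mul volume (𝓕 φ) 1
  set A := ∫ u, ‖𝓕 φ u‖
  set B := ∫ u, |u| * ‖𝓕 φ u‖
  have : 0 ≤ A := integral_nonneg fun u => norm_nonneg _
  have : 0 ≤ B := integral_nonneg fun u => by positivity
  rw [Metric.tendsto_nhds]
  intro ε hε
  obtain ⟨C, hC, hosc⟩ := hh.eventually_norm_sub_le hM (show 0 < ε / (3 * (A + 1)) by positivity)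
  obtain ⟨c, hc, hcB⟩ : ∃ c : ℝ, 0 < c ∧ C / c * B < ε / 3 :=
    ⟨3 * (C * B + 1) / ε, by positivity, by field_simp; linarith⟩
  filter_upwards [hosc, (tendsto_integral_fourier_mul_comp_add_div hm hM h0 hg hgh φ hφ
    hc).norm.eventually_lt_const (show ‖(0 : ℂ)‖ < ε / 3 by simpa using hε)] with τ hτ hlim
  have hAε : ε / (3 * (A + 1)) * A ≤ ε / 3 := by
    rw [div_mul_eq_mul_div, div_le_div_iff₀ (by positivity) (by positivity)]
    nlinarith
  rw [dist_zero_right]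
  linarith [norm_le_norm_integral_mul_comp_add_div hm hM hK hφ1 hKm hc hτ]

/-- The mean `x⁻¹ ∑_{k ≤ x} a k` at `x = exp t`, the function to which the Tauberian theorem
applies when `a` is a bounded sequence. -/
noncomputable def expMean (a : ℕ → ℂ) (t : ℝ) : ℂ :=
  (∑ k ∈ Finset.Icc 1 ⌊Real.exp t⌋₊, a k) * Real.exp (-t)

section ExpMean

variable {a : ℕ → ℂ} {M : ℝ}

theorem norm_sum_Ioc_le {m n : ℕ} (h : m ≤ n) (ha : ∀ k, ‖a k‖ ≤ M) :
    ‖∑ k ∈ Finset.Ioc m n, a k‖ ≤ M * (n - m) := by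
  refine (norm_sum_le_of_le _ fun k _ => ha k).trans_eq ?_
  rw [Finset.sum_const, Nat.card_Ioc, nsmul_eq_mul, Nat.cast_sub h, mul_comm]

theorem norm_sum_Icc_one_floor_exp_le (ha : ∀ k, ‖a k‖ ≤ M) (t : ℝ) :
    ‖∑ k ∈ Finset.Icc 1 ⌊Real.exp t⌋₊, a k‖ ≤ M * Real.exp t := by
  have hM : 0 ≤ M := (norm_nonneg _).trans (ha 0)
  refine (norm_sum_Ioc_le (Nat.zero_le _) ha).trans ?_
  rw [Nat.cast_zero, sub_zero]
  gcongr
  exact Nat.floor_le (Real.exp_pos t).le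

theorem norm_expMean_le (ha : ∀ k, ‖a k‖ ≤ M) (t : ℝ) : ‖expMean a t‖ ≤ M := by
  rw [expMean, norm_mul, Complex.norm_real, Real.norm_of_nonneg (Real.exp_pos _).le,
    Real.exp_neg, ← div_eq_mul_inv, div_le_iff₀ (Real.exp_pos t)]
  exact norm_sum_Icc_one_floor_exp_le ha t

theorem expMean_of_neg (a : ℕ → ℂ) {t : ℝ} (ht : t < 0) : expMean a t = 0 := by
  have : ⌊Real.exp t⌋₊ = 0 := Nat.floor_eq_zero.2 (by simpa using ht)
  simp [expMean, this]

theorem measurable_expMean (a : ℕ → ℂ) : Measurable (expMean a) :=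
  (((measurable_from_nat (f := fun n => ∑ k ∈ Finset.Icc 1 n, a k)).comp
    (Nat.measurable_floor.comp Real.measurable_exp))).mul (by fun_prop)

theorem norm_sum_Icc_floor_exp_sub_le (ha : ∀ k, ‖a k‖ ≤ M) {t u : ℝ} (h : t ≤ u) :
    ‖(∑ k ∈ Finset.Icc 1 ⌊Real.exp u⌋₊, a k) - ∑ k ∈ Finset.Icc 1 ⌊Real.exp t⌋₊, a k‖ ≤
      M * (Real.exp u - Real.exp t + 1) := by
  have hM : 0 ≤ M := (norm_nonneg _).trans (ha 0)
  have hfloor : ⌊Real.exp t⌋₊ ≤ ⌊Real.exp u⌋₊ := Nat.floor_mono (Real.exp_le_exp.2 h)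
  have hIcc (n : ℕ) : Finset.Icc 1 n = Finset.Ioc 0 n := rfl
  rw [hIcc, hIcc, ← Finset.sum_Ioc_consecutive _ (Nat.zero_le _) hfloor, add_sub_cancel_left]
  refine (norm_sum_Ioc_le hfloor ha).trans ?_
  gcongr
  linarith [Nat.floor_le (Real.exp_pos u).le, Nat.lt_floor_add_one (Real.exp t)]

theorem norm_expMean_sub_le_of_le (ha : ∀ k, ‖a k‖ ≤ M) {t u : ℝ} (h : t ≤ u) :
    ‖expMean a u - expMean a t‖ ≤ M * (2 * (u - t) + Real.exp (-u)) := by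
  have hM : 0 ≤ M := (norm_nonneg _).trans (ha 0)
  have hmono : Real.exp (-u) ≤ Real.exp (-t) := Real.exp_le_exp.2 (by linarith)
  set A := ∑ k ∈ Finset.Icc 1 ⌊Real.exp t⌋₊, a k
  set B := ∑ k ∈ Finset.Icc 1 ⌊Real.exp u⌋₊, a k
  have hsplit : expMean a u - expMean a t =
      (B - A) * (Real.exp (-u) : ℝ) - A * ((Real.exp (-t) - Real.exp (-u) : ℝ)) := by
    simp only [expMean, A, B]
    push_cast
    ring
  have hratio : Real.exp t * Real.exp (-u) = Real.exp (t - u) := by rw [← Real.exp_add]; ring_nf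
  have hcancel (x : ℝ) : Real.exp x * Real.exp (-x) = 1 := by rw [← Real.exp_add]; simp
  calc ‖expMean a u - expMean a t‖
      ≤ ‖B - A‖ * Real.exp (-u) + ‖A‖ * (Real.exp (-t) - Real.exp (-u)) := by
        rw [hsplit]
        refine (norm_sub_le _ _).trans_eq ?_
        rw [norm_mul, norm_mul, Complex.norm_real, Complex.norm_real,
          Real.norm_of_nonneg (Real.exp_pos _).le, Real.norm_of_nonneg (sub_nonneg.2 hmono)]
    _ ≤ M * (Real.exp u - Real.exp t + 1) * Real.exp (-u) +
          M * Real.exp t * (Real.exp (-t) - Real.exp (-u)) := by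
        have := sub_nonneg.2 hmono
        gcongr
        · exact norm_sum_Icc_floor_exp_sub_le ha h
        · exact norm_sum_Icc_one_floor_exp_le ha t
    _ = M * (2 * (1 - Real.exp (t - u)) + Real.exp (-u)) := by
        linear_combination M * hcancel u + M * hcancel t - 2 * M * hratio
    _ ≤ M * (2 * (u - t) + Real.exp (-u)) := by
        refine mul_le_mul_of_nonneg_left ?_ hM
        linarith [Real.add_one_le_exp (t - u)]

theorem norm_expMean_sub_le (ha : ∀ k, ‖a k‖ ≤ M) (t u : ℝ) :
    ‖expMean a u - expMean a t‖ ≤ M * (2 * |u - t| + Real.exp (-t)) := by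
  have hM : 0 ≤ M := (norm_nonneg _).trans (ha 0)
  rcases le_total t u with h | h
  · rw [abs_of_nonneg (sub_nonneg.2 h)]
    exact (norm_expMean_sub_le_of_le ha h).trans (by gcongr)
  · rw [norm_sub_rev, abs_sub_comm, abs_of_nonneg (sub_nonneg.2 h)]
    exact norm_expMean_sub_le_of_le ha h

theorem slowlyOscillating_expMean (ha : ∀ k, ‖a k‖ ≤ M) : SlowlyOscillating (expMean a) := by
  intro ε hε
  have hM : 0 ≤ M := (norm_nonneg _).trans (ha 0)
  refine ⟨ε / (4 * (M + 1)), by positivity, ?_⟩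
  have hexp : Tendsto (fun t => M * Real.exp (-t)) atTop (𝓝 0) := by
    simpa using Real.tendsto_exp_neg_atTop_nhds_zero.const_mul M
  filter_upwards [hexp.eventually_le_const (half_pos hε)] with t ht u hu
  have : M * (2 * (ε / (4 * (M + 1)))) ≤ ε / 2 := by
    field_simp
    linarith
  calc ‖expMean a u - expMean a t‖ ≤ M * (2 * |u - t|) + M * Real.exp (-t) := by
        rw [← mul_add]; exact norm_expMean_sub_le ha t u
    _ ≤ M * (2 * (ε / (4 * (M + 1)))) + ε / 2 := by gcongr
    _ ≤ ε := by linarith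

theorem integral_expMean_mul_exp_neg (ha : ∀ k, ‖a k‖ ≤ M) {s : ℂ} (hs : 0 < s.re) :
    ∫ t : ℝ, expMean a t * Complex.exp (-(s * t)) = LSeries a (s + 1) / (s + 1) := by
  have hs1 : s + 1 ≠ 0 := fun h => by
    have := congrArg Complex.re h
    simp only [Complex.add_re, Complex.one_re, Complex.zero_re] at this
    linarith
  have hO : (fun n => ∑ k ∈ Finset.Icc 1 n, ‖a k‖) =O[atTop] fun n => (n : ℝ) ^ (1 : ℝ) := by
    refine Asymptotics.IsBigO.of_bound M (.of_forall fun n => ?_)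
    rw [Real.norm_of_nonneg (Finset.sum_nonneg fun _ _ => norm_nonneg _)]
    simpa [mul_comm] using Finset.sum_le_sum (s := Finset.Icc 1 n) (fun k _ => ha k)
  have hvanish : ∀ t ∉ Set.Ici (0 : ℝ), expMean a t * Complex.exp (-(s * t)) = 0 := fun t ht => by
    rw [expMean_of_neg a (not_le.1 ht), zero_mul]
  rw [LSeries_eq_mul_integral' a zero_le_one (by simpa using hs) hO, mul_div_cancel_left₀ _ hs1,
    ← Real.exp_zero, ← integral_comp_exp_Ioi, ← setIntegral_eq_integral_of_forall_compl_eq_zero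
      hvanish, integral_Ici_eq_integral_Ioi]
  congr 1 with t
  rw [expMean, Complex.real_smul,
    Complex.cpow_def_of_ne_zero (by exact_mod_cast Real.exp_ne_zero t),
    ← Complex.ofReal_log (Real.exp_pos t).le, Real.log_exp]
  push_cast
  rw [mul_assoc, ← Complex.exp_add, mul_left_comm, ← Complex.exp_add]
  congr 2
  ring

theorem tendsto_mean_of_LSeries_continuousOn {G : ℂ → ℂ} (ha : ∀ k, ‖a k‖ ≤ M)
    (hG : ContinuousOn G {s | 1 ≤ s.re}) (haG : ∀ s : ℂ, 1 < s.re → LSeries a s = G s) :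
    Tendsto (fun N : ℕ => (1 / (N : ℂ)) * ∑ n ∈ Finset.Icc 1 N, a n) atTop (𝓝 0) := by
  have hcont : ContinuousOn (fun s => G (s + 1) / (s + 1)) {s | 0 ≤ s.re} := by
    refine (hG.comp (by fun_prop) fun s hs => by simpa using hs).div (by fun_prop) fun s hs h => ?_
    have := congrArg Complex.re h
    simp only [Complex.add_re, Complex.one_re, Complex.zero_re] at this
    linarith [Set.mem_ofPred.1 hs]
  have hmean : Tendsto (expMean a) atTop (𝓝 0) :=
    (slowlyOscillating_expMean ha).tendsto_zero_of_laplace (measurable_expMean a)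
      (norm_expMean_le ha) (fun t => expMean_of_neg a) hcont fun s hs => by
        rw [integral_expMean_mul_exp_neg ha hs, haG _ (by simpa using hs)]
  refine (hmean.comp (Real.tendsto_log_atTop.comp tendsto_natCast_atTop_atTop)).congr' ?_
  filter_upwards [eventually_gt_atTop 0] with N hN
  simp [expMean, Real.exp_neg, Real.exp_log (Nat.cast_pos.2 hN : (0 : ℝ) < N), mul_comm]

end ExpMean

end Tauberian

-- `riemannZeta 1` is a junk value, so the value `0` of `1 / ζ` at the pole is put in by hand.
theorem continuousOn_update_inv_riemannZeta :
    ContinuousOn (Function.update (fun s => (riemannZeta s)⁻¹) 1 0) {s | 1 ≤ s.re} := by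
  intro s hs
  refine ContinuousAt.continuousWithinAt ?_
  rcases eq_or_ne s 1 with rfl | hs1
  · refine continuousAt_update_same.2 ?_
    have := (tendsto_nhdsWithin_of_tendsto_nhds (tendsto_id.sub_const (1 : ℂ))).mul
      (riemannZeta_residue_one.inv₀ one_ne_zero)
    rw [sub_self, zero_mul] at this
    refine this.congr' ?_
    filter_upwards [self_mem_nhdsWithin] with s hs
    rw [mul_inv]
    exact mul_inv_cancel_left₀ (sub_ne_zero.2 hs) _
  · rw [continuousAt_update_of_ne hs1]
    exact (differentiableAt_riemannZeta hs1).continuousAt.inv₀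
      (riemannZeta_ne_zero_of_one_le_re hs)

theorem tendsto_mean_moebius :
    Tendsto (fun N : ℕ => (1 / (N : ℂ)) *
      ∑ n ∈ Finset.Icc 1 N, ((ArithmeticFunction.moebius n : ℤ) : ℂ)) atTop (𝓝 0) := by
  refine tendsto_mean_of_LSeries_continuousOn (M := 1) (fun n => ?_)
    continuousOn_update_inv_riemannZeta fun s hs => ?_
  · rw [Complex.norm_intCast]
    exact_mod_cast ArithmeticFunction.abs_moebius_le_one
  · have hs1 : s ≠ 1 := by rintro rfl; simp at hs
    rw [Function.update_of_ne hs1, ← LSeries_one_eq_riemannZeta hs]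
    exact eq_inv_of_mul_eq_one_right (LSeries_one_mul_Lseries_moebius hs)

theorem eventually_differentPrimesAtTop_iff {p : ℕ × ℕ → Prop} :
    (∀ᶠ x in differentPrimesAtTop, p x) ↔
      ∃ P₀, ∀ r ≥ P₀, ∀ s ≥ P₀, r.Prime → s.Prime → r ≠ s → p (r, s) := by
  rw [differentPrimesAtTop, eventually_inf_principal, prod_atTop_atTop_eq,
    eventually_atTop_prod_self]
  exact exists_congr fun P₀ =>
    ⟨fun h r hr s hs hrp hsp hrs => h r s hr hs ⟨hrp, hsp, hrs⟩,
      fun h r s hr hs hrs => h r hr s hs hrs.1 hrs.2.1 hrs.2.2⟩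

section TuranKubilius

theorem sum_Icc_filter_dvd {R : Type*} [AddCommMonoid R] (c : ℕ → R) {p : ℕ} (hp : 0 < p)
    (N : ℕ) :
    ∑ n ∈ Finset.Icc 1 N with p ∣ n, c n = ∑ m ∈ Finset.Icc 1 (N / p), c (p * m) := by
  symm
  refine Finset.sum_bij (fun m _ => p * m) (fun m hm => ?_)
    (fun m _ m' _ h => Nat.eq_of_mul_eq_mul_left hp h) (fun n hn => ?_) (fun _ _ => rfl)
  · rw [Finset.mem_Icc, Nat.le_div_iff_mul_le hp, mul_comm] at hm
    exact Finset.mem_filter.2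
      ⟨Finset.mem_Icc.2 ⟨Nat.mul_pos hp hm.1, hm.2⟩, dvd_mul_right _ _⟩
  · obtain ⟨hn, m, rfl⟩ := Finset.mem_filter.1 hn
    rw [Finset.mem_Icc] at hn
    refine ⟨m, ?_, rfl⟩
    rw [Finset.mem_Icc, Nat.le_div_iff_mul_le hp, mul_comm]
    exact ⟨Nat.pos_of_mul_pos_left hn.1, hn.2⟩

variable {P : Finset ℕ}

theorem sum_card_filter_dvd_mul {R : Type*} [NonAssocSemiring R] (hP : ∀ p ∈ P, 0 < p)
    (c : ℕ → R) (N : ℕ) :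
    ∑ n ∈ Finset.Icc 1 N, ({p ∈ P | p ∣ n}.card : R) * c n =
      ∑ p ∈ P, ∑ m ∈ Finset.Icc 1 (N / p), c (p * m) := by
  have hcard (n : ℕ) :
      ({p ∈ P | p ∣ n}.card : R) * c n = ∑ p ∈ P, if p ∣ n then c n else 0 := by
    rw [← Finset.sum_filter, Finset.sum_const, nsmul_eq_mul]
  simp_rw [hcard]
  rw [Finset.sum_comm]
  refine Finset.sum_congr rfl fun p hp => ?_
  rw [← Finset.sum_filter, sum_Icc_filter_dvd c (hP p hp)]

theorem sum_card_filter_dvd (hP : ∀ p ∈ P, 0 < p) (N : ℕ) :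
    ∑ n ∈ Finset.Icc 1 N, ({p ∈ P | p ∣ n}.card : ℝ) = ∑ p ∈ P, ((N / p : ℕ) : ℝ) := by
  simpa using sum_card_filter_dvd_mul (R := ℝ) hP (fun _ => 1) N

theorem sum_card_filter_dvd_le (hP : ∀ p ∈ P, 0 < p) (N : ℕ) :
    ∑ n ∈ Finset.Icc 1 N, ({p ∈ P | p ∣ n}.card : ℝ) ≤ N * ∑ p ∈ P, (p : ℝ)⁻¹ := by
  rw [sum_card_filter_dvd hP, Finset.mul_sum]
  exact Finset.sum_le_sum fun p _ => Nat.cast_div_le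

theorem le_sum_card_filter_dvd (hP : ∀ p ∈ P, 0 < p) (N : ℕ) :
    (N * ∑ p ∈ P, (p : ℝ)⁻¹) - P.card ≤ ∑ n ∈ Finset.Icc 1 N, ({p ∈ P | p ∣ n}.card : ℝ) := by
  rw [sum_card_filter_dvd hP, Finset.mul_sum, Finset.card_eq_sum_ones, Nat.cast_sum,
    ← Finset.sum_sub_distrib]
  refine Finset.sum_le_sum fun p hp => ?_
  have hp0 : (0 : ℝ) < p := Nat.cast_pos.2 (hP p hp)
  have : (N : ℝ) < (N / p : ℕ) * p + p := by exact_mod_cast Nat.lt_div_mul_add (hP p hp)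
  rw [← div_eq_mul_inv, sub_le_iff_le_add, div_le_iff₀ hp0]
  push_cast
  linarith

theorem card_filter_dvd_mul_le (hco : (P : Set ℕ).Pairwise Nat.Coprime) {p : ℕ} (hp : p ∈ P)
    (m : ℕ) : {q ∈ P | q ∣ p * m}.card ≤ {q ∈ P | q ∣ m}.card + 1 := by
  refine (Finset.card_le_card fun q hq => ?_).trans (Finset.card_insert_le p _)
  obtain ⟨hq, hdvd⟩ := Finset.mem_filter.1 hq
  rw [Finset.mem_insert, Finset.mem_filter]
  rcases eq_or_ne q p with h | h
  · exact .inl h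
  · exact .inr ⟨hq, (hco hq hp h).dvd_of_dvd_mul_left hdvd⟩

theorem sum_sq_card_filter_dvd_le (hP : ∀ p ∈ P, 0 < p)
    (hco : (P : Set ℕ).Pairwise Nat.Coprime) (N : ℕ) :
    ∑ n ∈ Finset.Icc 1 N, ({p ∈ P | p ∣ n}.card : ℝ) ^ 2 ≤
      N * (∑ p ∈ P, (p : ℝ)⁻¹) ^ 2 + N * ∑ p ∈ P, (p : ℝ)⁻¹ := by
  set A := ∑ p ∈ P, (p : ℝ)⁻¹
  have : 0 ≤ A := Finset.sum_nonneg fun p _ => by positivity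
  calc ∑ n ∈ Finset.Icc 1 N, ({p ∈ P | p ∣ n}.card : ℝ) ^ 2
      = ∑ p ∈ P, ∑ m ∈ Finset.Icc 1 (N / p), ({q ∈ P | q ∣ p * m}.card : ℝ) := by
        simp_rw [sq]
        exact sum_card_filter_dvd_mul hP (fun n => ({p ∈ P | p ∣ n}.card : ℝ)) N
    _ ≤ ∑ p ∈ P, ∑ m ∈ Finset.Icc 1 (N / p), (({q ∈ P | q ∣ m}.card : ℝ) + 1) :=
        Finset.sum_le_sum fun p hp => Finset.sum_le_sum fun m _ => by
          exact_mod_cast card_filter_dvd_mul_le hco hp m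
    _ ≤ ∑ p ∈ P, ((N / p : ℕ) : ℝ) * (A + 1) :=
        Finset.sum_le_sum fun p _ => by
          rw [Finset.sum_add_distrib, mul_add]
          gcongr
          · exact sum_card_filter_dvd_le hP _
          · simp
    _ ≤ N * A * (A + 1) := by
        rw [← Finset.sum_mul, ← sum_card_filter_dvd hP]
        gcongr
        exact sum_card_filter_dvd_le hP N
    _ = N * A ^ 2 + N * A := by ring

theorem sum_sq_card_filter_dvd_sub_le (hP : ∀ p ∈ P, 0 < p)
    (hco : (P : Set ℕ).Pairwise Nat.Coprime) (N : ℕ) :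
    ∑ n ∈ Finset.Icc 1 N, (({p ∈ P | p ∣ n}.card : ℝ) - ∑ p ∈ P, (p : ℝ)⁻¹) ^ 2 ≤
      (∑ p ∈ P, (p : ℝ)⁻¹) * (N + 2 * P.card) := by
  set A := ∑ p ∈ P, (p : ℝ)⁻¹
  have hA : 0 ≤ A := Finset.sum_nonneg fun p _ => by positivity
  have hexpand : ∑ n ∈ Finset.Icc 1 N, (({p ∈ P | p ∣ n}.card : ℝ) - A) ^ 2 =
      ∑ n ∈ Finset.Icc 1 N, ({p ∈ P | p ∣ n}.card : ℝ) ^ 2 -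
        2 * A * ∑ n ∈ Finset.Icc 1 N, ({p ∈ P | p ∣ n}.card : ℝ) + N * A ^ 2 := by
    simp_rw [sub_sq, Finset.sum_add_distrib, Finset.sum_sub_distrib, Finset.mul_sum,
      mul_right_comm (2 : ℝ)]
    simp
  have hfirst := mul_le_mul_of_nonneg_left (le_sum_card_filter_dvd hP N) hA
  rw [hexpand]
  linarith [sum_sq_card_filter_dvd_le hP hco N]

theorem norm_sum_mul_sum_sub_sum_dilate_le (hP : ∀ p ∈ P, 0 < p)
    (hco : (P : Set ℕ).Pairwise Nat.Coprime) {c : ℕ → ℂ} (hc : ∀ n, ‖c n‖ ≤ 1) (N : ℕ) :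
    ‖((∑ p ∈ P, (p : ℝ)⁻¹ : ℝ) : ℂ) * ∑ n ∈ Finset.Icc 1 N, c n -
        ∑ p ∈ P, ∑ m ∈ Finset.Icc 1 (N / p), c (p * m)‖ ≤
      √(N * ((∑ p ∈ P, (p : ℝ)⁻¹) * (N + 2 * P.card))) := by
  set A := ∑ p ∈ P, (p : ℝ)⁻¹
  rw [← sum_card_filter_dvd_mul hP, Finset.mul_sum, ← Finset.sum_sub_distrib]
  calc ‖∑ n ∈ Finset.Icc 1 N, ((A : ℂ) * c n - ({p ∈ P | p ∣ n}.card : ℂ) * c n)‖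
      ≤ ∑ n ∈ Finset.Icc 1 N, |({p ∈ P | p ∣ n}.card : ℝ) - A| := by
        refine norm_sum_le_of_le _ fun n _ => ?_
        rw [← sub_mul, norm_mul, norm_sub_rev, ← Complex.ofReal_natCast, ← Complex.ofReal_sub,
          Complex.norm_real, Real.norm_eq_abs]
        exact mul_le_of_le_one_right (abs_nonneg _) (hc n)
    _ ≤ √(N * (A * (N + 2 * P.card))) := by
        refine Real.le_sqrt_of_sq_le (sq_sum_le_card_mul_sum_sq.trans ?_)
        simp only [sq_abs, Nat.card_Icc, add_tsub_cancel_right]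
        gcongr
        exact sum_sq_card_filter_dvd_sub_le hP hco N

end TuranKubilius

section OrthogonalityCriterion

theorem sum_sq_norm_sum_le {ι κ : Type*} (B : Finset ι) (t : Finset κ) (f : ι → κ → ℂ) :
    ∑ m ∈ t, ‖∑ p ∈ B, f p m‖ ^ 2 ≤
      ∑ p ∈ B, ∑ q ∈ B, ‖∑ m ∈ t, f p m * starRingEnd ℂ (f q m)‖ := by
  have hexpand : ((∑ m ∈ t, ‖∑ p ∈ B, f p m‖ ^ 2 : ℝ) : ℂ) =
      ∑ p ∈ B, ∑ q ∈ B, ∑ m ∈ t, f p m * starRingEnd ℂ (f q m) := by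
    simp_rw [Complex.ofReal_sum, Complex.ofReal_pow, ← Complex.mul_conj', map_sum,
      Finset.sum_mul_sum]
    rw [Finset.sum_comm]
    exact Finset.sum_congr rfl fun p _ => Finset.sum_comm
  calc ∑ m ∈ t, ‖∑ p ∈ B, f p m‖ ^ 2 = ‖((∑ m ∈ t, ‖∑ p ∈ B, f p m‖ ^ 2 : ℝ) : ℂ)‖ := by
        rw [Complex.norm_real, Real.norm_of_nonneg (Finset.sum_nonneg fun _ _ => sq_nonneg _)]
    _ ≤ _ := by
        rw [hexpand]
        exact norm_sum_le_of_le _ fun p _ => norm_sum_le _ _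

theorem sq_norm_sum_sum_mul_le {ι κ : Type*} (B : Finset ι) (t : Finset κ) (f : ι → κ → ℂ)
    {v : κ → ℂ} (hv : ∀ m, ‖v m‖ ≤ 1) :
    ‖∑ p ∈ B, ∑ m ∈ t, f p m * v m‖ ^ 2 ≤
      t.card * ∑ p ∈ B, ∑ q ∈ B, ‖∑ m ∈ t, f p m * starRingEnd ℂ (f q m)‖ := by
  rw [Finset.sum_comm]
  calc ‖∑ m ∈ t, ∑ p ∈ B, f p m * v m‖ ^ 2 ≤ (∑ m ∈ t, ‖∑ p ∈ B, f p m‖) ^ 2 := by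
        gcongr
        refine norm_sum_le_of_le _ fun m _ => ?_
        rw [← Finset.sum_mul, norm_mul]
        exact mul_le_of_le_one_right (norm_nonneg _) (hv m)
    _ ≤ t.card * ∑ m ∈ t, ‖∑ p ∈ B, f p m‖ ^ 2 := sq_sum_le_card_mul_sum_sq
    _ ≤ _ := by
        gcongr
        exact sum_sq_norm_sum_le B t f

variable {F : ℕ → ℂ} {B : Finset ℕ} {Q : ℕ}

theorem sq_norm_sum_mul_sum_dilate_le {b v : ℕ → ℂ} (hb : ∀ n, ‖b n‖ ≤ 1)
    (hv : ∀ n, ‖v n‖ ≤ 1) (hQ : 0 < Q) (hB : ∀ p ∈ B, Q ≤ p) (N : ℕ) :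
    ‖∑ p ∈ B, b p * ∑ m ∈ Finset.Icc 1 (N / p), F (p * m) * v m‖ ^ 2 ≤
      (N / Q : ℕ) * ∑ p ∈ B, ∑ q ∈ B,
        ‖∑ m ∈ Finset.Icc 1 (min (N / p) (N / q)), F (p * m) * starRingEnd ℂ (F (q * m))‖ := by
  have hIcc {M : ℕ} (hM : M ≤ N / Q) (c : ℕ → ℂ) :
      ∑ m ∈ Finset.Icc 1 (N / Q), (if m ≤ M then c m else 0) = ∑ m ∈ Finset.Icc 1 M, c m := by
    rw [← Finset.sum_filter]
    congr 1
    ext m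
    simp only [Finset.mem_filter, Finset.mem_Icc]
    omega
  have hdiv {p : ℕ} (hp : p ∈ B) : N / p ≤ N / Q := Nat.div_le_div_left (hB p hp) hQ
  set f : ℕ → ℕ → ℂ := fun p m => if m ≤ N / p then b p * F (p * m) else 0 with hf
  have hsum : ∑ p ∈ B, b p * ∑ m ∈ Finset.Icc 1 (N / p), F (p * m) * v m =
      ∑ p ∈ B, ∑ m ∈ Finset.Icc 1 (N / Q), f p m * v m :=
    Finset.sum_congr rfl fun p hp => by
      simp_rw [hf, ite_mul, zero_mul]
      rw [hIcc (hdiv hp), Finset.mul_sum]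
      simp_rw [mul_assoc]
  have hcor : ∀ p ∈ B, ∀ q ∈ B,
      ∑ m ∈ Finset.Icc 1 (N / Q), f p m * starRingEnd ℂ (f q m) =
        b p * starRingEnd ℂ (b q) * ∑ m ∈ Finset.Icc 1 (min (N / p) (N / q)),
          F (p * m) * starRingEnd ℂ (F (q * m)) := fun p hp q _ => by
    rw [Finset.mul_sum, ← hIcc ((min_le_left _ _).trans (hdiv hp))]
    refine Finset.sum_congr rfl fun m _ => ?_
    by_cases hmp : m ≤ N / p <;> by_cases hmq : m ≤ N / q <;> simp [hf, hmp, hmq]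
    ring
  rw [hsum]
  refine (sq_norm_sum_sum_mul_le B _ f hv).trans ?_
  rw [Nat.card_Icc, Nat.add_sub_cancel]
  gcongr with p hp q hq
  rw [hcor p hp q hq, norm_mul, norm_mul, RCLike.norm_conj]
  exact mul_le_of_le_one_left (norm_nonneg _) (mul_le_one₀ (hb p) (norm_nonneg _) (hb q))

theorem norm_correlation_le {ε : ℝ} (hε : 0 ≤ ε) (hF : ∀ n, ‖F n‖ ≤ 1) (hQ : 0 < Q)
    {p q : ℕ} (hp : Q ≤ p) (N : ℕ)
    (hcor : p ≠ q →
      ‖∑ m ∈ Finset.Icc 1 (min (N / p) (N / q)), F (p * m) * starRingEnd ℂ (F (q * m))‖ ≤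
        ε * (min (N / p) (N / q) : ℕ)) :
    ‖∑ m ∈ Finset.Icc 1 (min (N / p) (N / q)), F (p * m) * starRingEnd ℂ (F (q * m))‖ ≤
      (if p = q then (N / Q : ℝ) else 0) + ε * (N / Q) := by
  have hmin : ((min (N / p) (N / q) : ℕ) : ℝ) ≤ N / Q := by
    have : (Q : ℝ) ≤ p := by exact_mod_cast hp
    calc ((min (N / p) (N / q) : ℕ) : ℝ) ≤ (N / p : ℕ) := by exact_mod_cast min_le_left _ _
      _ ≤ N / p := Nat.cast_div_le
      _ ≤ N / Q := by gcongr
  split_ifs with hpq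
  · have htrivial : ‖∑ m ∈ Finset.Icc 1 (min (N / p) (N / q)),
        F (p * m) * starRingEnd ℂ (F (q * m))‖ ≤ (min (N / p) (N / q) : ℕ) := by
      refine (norm_sum_le_of_le _ (n := fun _ => 1) fun m _ => ?_).trans_eq (by simp)
      rw [norm_mul, RCLike.norm_conj]
      exact mul_le_one₀ (hF _) (norm_nonneg _) (hF _)
    exact (htrivial.trans hmin).trans (le_add_of_nonneg_right (by positivity))
  · rw [zero_add]
    exact (hcor hpq).trans (by gcongr)

theorem card_div_le_two_mul_sum_inv (hQ : 0 < Q) (hB : B ⊆ Finset.Ico Q (2 * Q)) :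
    (B.card : ℝ) / Q ≤ 2 * ∑ p ∈ B, (p : ℝ)⁻¹ := by
  rw [Finset.card_eq_sum_ones, Nat.cast_sum, Finset.sum_div, Finset.mul_sum]
  refine Finset.sum_le_sum fun p hp => ?_
  have hmem := Finset.mem_Ico.1 (hB hp)
  have hp0 : (0 : ℝ) < p := Nat.cast_pos.2 (hQ.trans_le hmem.1)
  have hp2 : (p : ℝ) ≤ 2 * Q := by exact_mod_cast hmem.2.le
  rw [← div_eq_mul_inv, div_le_div_iff₀ (by positivity) hp0]
  simpa using hp2

theorem norm_sum_mul_sum_dilate_le {b v : ℕ → ℂ} {ε : ℝ} {N : ℕ} (hε : 0 ≤ ε)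
    (hF : ∀ n, ‖F n‖ ≤ 1) (hb : ∀ n, ‖b n‖ ≤ 1) (hv : ∀ n, ‖v n‖ ≤ 1) (hQ : 0 < Q)
    (hB : B ⊆ Finset.Ico Q (2 * Q))
    (hcor : ∀ p ∈ B, ∀ q ∈ B, p ≠ q →
      ‖∑ m ∈ Finset.Icc 1 (min (N / p) (N / q)), F (p * m) * starRingEnd ℂ (F (q * m))‖ ≤
        ε * (min (N / p) (N / q) : ℕ)) :
    ‖∑ p ∈ B, b p * ∑ m ∈ Finset.Icc 1 (N / p), F (p * m) * v m‖ ≤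
      N * ((√Q)⁻¹ + 2 * √ε * ∑ p ∈ B, (p : ℝ)⁻¹) := by
  have hBQ : ∀ p ∈ B, Q ≤ p := fun p hp => (Finset.mem_Ico.1 (hB hp)).1
  have hcard : (B.card : ℝ) / Q ≤ 1 := by
    rw [div_le_one (Nat.cast_pos.2 hQ)]
    simpa [two_mul] using Finset.card_le_card hB
  set x : ℝ := N / Q
  set k : ℝ := (B.card : ℝ) / Q
  have hsq : ‖∑ p ∈ B, b p * ∑ m ∈ Finset.Icc 1 (N / p), F (p * m) * v m‖ ^ 2 ≤
      N ^ 2 * ((Q : ℝ)⁻¹ + ε * k ^ 2) := by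
    calc _ ≤ (N / Q : ℕ) * ∑ p ∈ B, ∑ q ∈ B, ‖∑ m ∈ Finset.Icc 1 (min (N / p) (N / q)),
              F (p * m) * starRingEnd ℂ (F (q * m))‖ :=
          sq_norm_sum_mul_sum_dilate_le hb hv hQ hBQ N
      _ ≤ x * ∑ p ∈ B, ∑ q ∈ B, ((if p = q then x else 0) + ε * x) := by
          gcongr with p hp q hq
          · exact Nat.cast_div_le
          · exact norm_correlation_le hε hF hQ (hBQ p hp) N (hcor p hp q hq)
      _ = N ^ 2 * (k * (Q : ℝ)⁻¹ + ε * k ^ 2) := by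
          simp only [Finset.sum_add_distrib, Finset.sum_ite_eq, Finset.sum_ite_mem,
            Finset.inter_self, Finset.sum_const, nsmul_eq_mul, x, k]
          field_simp
      _ ≤ N ^ 2 * ((Q : ℝ)⁻¹ + ε * k ^ 2) := by
          gcongr
          exact mul_le_of_le_one_left (by positivity) hcard
  calc _ ≤ √(N ^ 2 * ((Q : ℝ)⁻¹ + ε * k ^ 2)) := Real.le_sqrt_of_sq_le hsq
    _ = N * √((Q : ℝ)⁻¹ + ε * k ^ 2) := by
        rw [Real.sqrt_mul (by positivity), Real.sqrt_sq (by positivity)]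
    _ ≤ N * (√((Q : ℝ)⁻¹) + √(ε * k ^ 2)) := by
        gcongr
        refine Real.sqrt_le_iff.2 ⟨by positivity, ?_⟩
        rw [add_sq, Real.sq_sqrt (by positivity), Real.sq_sqrt (by positivity)]
        linarith [show 0 ≤ 2 * √((Q : ℝ)⁻¹) * √(ε * k ^ 2) by positivity]
    _ = N * ((√Q)⁻¹ + √ε * k) := by
        rw [Real.sqrt_inv, Real.sqrt_mul hε, Real.sqrt_sq (by positivity)]
    _ ≤ N * ((√Q)⁻¹ + √ε * (2 * ∑ p ∈ B, (p : ℝ)⁻¹)) := by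
        gcongr
        exact card_div_le_two_mul_sum_inv hQ hB
    _ = _ := by ring

theorem eventually_forall_norm_correlation_le {ε : ℝ} (hB : ∀ p ∈ B, 0 < p)
    (hcor : ∀ p ∈ B, ∀ q ∈ B, p ≠ q → ∀ᶠ M : ℕ in atTop,
      ‖∑ m ∈ Finset.Icc 1 M, F (p * m) * starRingEnd ℂ (F (q * m))‖ ≤ ε * M) :
    ∀ᶠ N : ℕ in atTop, ∀ p ∈ B, ∀ q ∈ B, p ≠ q →
      ‖∑ m ∈ Finset.Icc 1 (min (N / p) (N / q)), F (p * m) * starRingEnd ℂ (F (q * m))‖ ≤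
        ε * (min (N / p) (N / q) : ℕ) := by
  simp_rw [eventually_all_finset, eventually_imp_distrib_left]
  intro p hp q hq hpq
  obtain ⟨M, hM⟩ := eventually_atTop.1 (hcor p hp q hq hpq)
  filter_upwards [(Nat.tendsto_div_const_atTop (hB p hp).ne').eventually_ge_atTop M,
    (Nat.tendsto_div_const_atTop (hB q hq).ne').eventually_ge_atTop M] with N hNp hNq
  exact hM _ (le_min hNp hNq)

/-- The primes in `[2 ^ J, 2 ^ K)`; a union of the blocks `dyadicPrimes j (j + 1)`, on each of which
`p` is constant up to a factor of two. -/
def dyadicPrimes (J K : ℕ) : Finset ℕ :=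
  {p ∈ Finset.Ico (2 ^ J) (2 ^ K) | p.Prime}

theorem sum_dyadicPrimes_eq_sum_Ico {M : Type*} [AddCommMonoid M] (X : ℕ → M) {J K : ℕ}
    (h : J ≤ K) :
    ∑ p ∈ dyadicPrimes J K, X p =
      ∑ j ∈ Finset.Ico J K, ∑ p ∈ dyadicPrimes j (j + 1), X p := by
  induction K, h using Nat.le_induction with
  | base => simp [dyadicPrimes]
  | succ K hK ih =>
    rw [Finset.sum_Ico_succ_top hK, ← ih]
    simp_rw [dyadicPrimes, Finset.sum_filter]
    exact (Finset.sum_Ico_consecutive _ (Nat.pow_le_pow_right two_pos hK)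
      (Nat.pow_le_pow_right two_pos K.le_succ)).symm

theorem tendsto_sum_inv_dyadicPrimes (J : ℕ) :
    Tendsto (fun K => ∑ p ∈ dyadicPrimes J K, (p : ℝ)⁻¹) atTop atTop := by
  set f : ℕ → ℝ := {p | p.Prime}.indicator fun n => 1 / (n : ℝ) with hf
  have hdiv : Tendsto (fun n => ∑ i ∈ Finset.range n, f i) atTop atTop :=
    (not_summable_iff_tendsto_nat_atTop_of_nonneg
      (Set.indicator_nonneg fun _ _ => by positivity)).1 not_summable_one_div_on_primes
  refine (tendsto_atTop_add_const_right _ (-∑ i ∈ Finset.range (2 ^ J), f i)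
    (hdiv.comp (tendsto_pow_atTop_atTop_of_one_lt one_lt_two))).congr' ?_
  filter_upwards [eventually_ge_atTop J] with K hK
  rw [Function.comp_apply, ← sub_eq_add_neg,
    ← Finset.sum_Ico_eq_sub _ (Nat.pow_le_pow_right two_pos hK), dyadicPrimes, Finset.sum_filter]
  simp only [hf, Set.indicator_apply, Set.mem_ofPred, one_div]

theorem summable_inv_sqrt_two_pow : Summable fun j : ℕ => (√2)⁻¹ ^ j :=
  summable_geometric_of_lt_one (by positivity)
    (inv_lt_one_of_one_lt₀ (Real.lt_sqrt_of_sq_lt (by norm_num)))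

theorem eventually_norm_sum_dyadicPrimes_le {b v : ℕ → ℂ} {ε : ℝ} {J K : ℕ} (hε : 0 ≤ ε)
    (hF : ∀ n, ‖F n‖ ≤ 1) (hb : ∀ n, ‖b n‖ ≤ 1) (hv : ∀ n, ‖v n‖ ≤ 1) (hJK : J ≤ K)
    (hcor : ∀ p ≥ 2 ^ J, ∀ q ≥ 2 ^ J, p.Prime → q.Prime → p ≠ q → ∀ᶠ M : ℕ in atTop,
      ‖∑ m ∈ Finset.Icc 1 M, F (p * m) * starRingEnd ℂ (F (q * m))‖ ≤ ε * M) :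
    ∀ᶠ N : ℕ in atTop,
      ‖∑ p ∈ dyadicPrimes J K,
          b p * ∑ m ∈ Finset.Icc 1 (N / p), F (p * m) * v m‖ ≤
        N * (∑' j : ℕ, (√2)⁻¹ ^ j +
          2 * √ε * ∑ p ∈ dyadicPrimes J K, (p : ℝ)⁻¹) := by
  have hev : ∀ᶠ N : ℕ in atTop, ∀ j ∈ Finset.Ico J K,
      ‖∑ p ∈ dyadicPrimes j (j + 1),
          b p * ∑ m ∈ Finset.Icc 1 (N / p), F (p * m) * v m‖ ≤
        N * ((√2)⁻¹ ^ j +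
          2 * √ε * ∑ p ∈ dyadicPrimes j (j + 1), (p : ℝ)⁻¹) := by
    rw [eventually_all_finset]
    intro j hj
    have hJ : ∀ p ∈ Finset.Ico (2 ^ j) (2 ^ (j + 1)), 2 ^ J ≤ p := fun p hp =>
      (Nat.pow_le_pow_right two_pos (Finset.mem_Ico.1 hj).1).trans (Finset.mem_Ico.1 hp).1
    have hcor' := eventually_forall_norm_correlation_le
      (F := F) (B := dyadicPrimes j (j + 1)) (ε := ε)
      (fun p hp => (Finset.mem_filter.1 hp).2.pos) fun p hp q hq => by
        rw [dyadicPrimes, Finset.mem_filter] at hp hq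
        exact hcor p (hJ p hp.1) q (hJ q hq.1) hp.2 hq.2
    filter_upwards [hcor'] with N hN
    have hblock := norm_sum_mul_sum_dilate_le (Q := 2 ^ j) hε hF hb hv (by positivity)
      (by rw [← pow_succ']; exact Finset.filter_subset _ _) hN
    have hsqrt : √(2 ^ j : ℝ) = √2 ^ j := by
      rw [Real.sqrt_eq_iff_mul_self_eq (by positivity) (by positivity), ← mul_pow,
        Real.mul_self_sqrt zero_le_two]
    rwa [Nat.cast_pow, Nat.cast_ofNat, hsqrt, ← inv_pow] at hblock
  filter_upwards [hev] with N hN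
  simp_rw [sum_dyadicPrimes_eq_sum_Ico _ hJK]
  refine (norm_sum_le_of_le _ hN).trans ?_
  rw [← Finset.mul_sum, Finset.sum_add_distrib, ← Finset.mul_sum]
  gcongr
  exact summable_inv_sqrt_two_pow.sum_le_tsum _ fun j _ => by positivity

variable {u : ArithmeticFunction ℂ}

theorem norm_sum_dilate_mul_sub_le (hF : ∀ n, ‖F n‖ ≤ 1) (hu : u.IsMultiplicative)
    (hu1 : ∀ n, ‖u n‖ ≤ 1) {p : ℕ} (hp : p.Prime) (N : ℕ) :
    ‖∑ m ∈ Finset.Icc 1 (N / p), F (p * m) * u (p * m) -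
        u p * ∑ m ∈ Finset.Icc 1 (N / p), F (p * m) * u m‖ ≤ 2 * N * (1 / (p : ℝ) ^ 2) := by
  have hterm (m : ℕ) : ‖F (p * m) * u (p * m) - u p * (F (p * m) * u m)‖ ≤
      if p ∣ m then 2 else 0 := by
    split_ifs with hpm
    · calc _ ≤ ‖F (p * m) * u (p * m)‖ + ‖u p * (F (p * m) * u m)‖ := norm_sub_le _ _
        _ ≤ 1 + 1 := by
            simp only [norm_mul]
            exact add_le_add (mul_le_one₀ (hF _) (norm_nonneg _) (hu1 _))
              (mul_le_one₀ (hu1 p) (by positivity)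
                (mul_le_one₀ (hF _) (norm_nonneg _) (hu1 m)))
        _ = 2 := one_add_one_eq_two
    · rw [hu.map_mul_of_coprime ((Nat.Prime.coprime_iff_not_dvd hp).2 hpm), mul_left_comm,
        sub_self, norm_zero]
  rw [Finset.mul_sum, ← Finset.sum_sub_distrib]
  calc _ ≤ ∑ m ∈ Finset.Icc 1 (N / p), (if p ∣ m then (2 : ℝ) else 0) :=
        norm_sum_le_of_le _ fun m _ => hterm m
    _ = 2 * ((N / (p * p) : ℕ) : ℝ) := by
        rw [← Finset.sum_filter, sum_Icc_filter_dvd _ hp.pos, Nat.div_div_eq_div_mul]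
        simp [mul_comm]
    _ ≤ 2 * (N / (p * p : ℕ)) := by
        gcongr
        exact Nat.cast_div_le
    _ = 2 * N * (1 / (p : ℝ) ^ 2) := by
        push_cast
        ring

theorem sum_inv_mul_norm_sum_mul_le (hF : ∀ n, ‖F n‖ ≤ 1) (hu : u.IsMultiplicative)
    (hu1 : ∀ n, ‖u n‖ ≤ 1) {P : Finset ℕ} (hP : ∀ p ∈ P, p.Prime) {N : ℕ}
    (hN : 2 * P.card ≤ N) {D : ℝ}
    (hD : ‖∑ p ∈ P, u p * ∑ m ∈ Finset.Icc 1 (N / p), F (p * m) * u m‖ ≤ N * D) :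
    (∑ p ∈ P, (p : ℝ)⁻¹) * ‖∑ n ∈ Finset.Icc 1 N, F n * u n‖ ≤
      N * (√(2 * ∑ p ∈ P, (p : ℝ)⁻¹) + 2 * ∑' n : ℕ, 1 / (n : ℝ) ^ 2 + D) := by
  set A := ∑ p ∈ P, (p : ℝ)⁻¹
  have hA : 0 ≤ A := Finset.sum_nonneg fun p _ => by positivity
  set S := ∑ n ∈ Finset.Icc 1 N, F n * u n
  set W := ∑ p ∈ P, ∑ m ∈ Finset.Icc 1 (N / p), F (p * m) * u (p * m)
  set V := ∑ p ∈ P, u p * ∑ m ∈ Finset.Icc 1 (N / p), F (p * m) * u m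
  have hSW : ‖(A : ℂ) * S - W‖ ≤ N * √(2 * A) := by
    calc _ ≤ √(N * (A * (N + 2 * P.card))) :=
          norm_sum_mul_sum_sub_sum_dilate_le (fun p hp => (hP p hp).pos)
            (fun p hp q hq => (Nat.coprime_primes (hP p hp) (hP q hq)).2)
            (fun n => (norm_mul_le _ _).trans (mul_le_one₀ (hF n) (norm_nonneg _) (hu1 n))) N
      _ ≤ √(N * (A * (N + N))) := by
          gcongr
          exact_mod_cast hN
      _ = N * √(2 * A) := by
          rw [← Real.sqrt_sq (Nat.cast_nonneg N), ← Real.sqrt_mul (by positivity),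
            Real.sqrt_sq (Nat.cast_nonneg N)]
          ring_nf
  have hWV : ‖W - V‖ ≤ N * (2 * ∑' n : ℕ, 1 / (n : ℝ) ^ 2) := by
    calc ‖W - V‖ ≤ ∑ p ∈ P, 2 * N * (1 / (p : ℝ) ^ 2) := by
          rw [← Finset.sum_sub_distrib]
          exact norm_sum_le_of_le _ fun p hp => norm_sum_dilate_mul_sub_le hF hu hu1 (hP p hp) N
      _ = N * (2 * ∑ p ∈ P, 1 / (p : ℝ) ^ 2) := by rw [← Finset.mul_sum]; ring
      _ ≤ _ := by
          gcongr
          exact (Real.summable_one_div_nat_pow.2 one_lt_two).sum_le_tsum P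
            fun _ _ => by positivity
  calc A * ‖S‖ = ‖(A : ℂ) * S‖ := by rw [norm_mul, Complex.norm_real, Real.norm_of_nonneg hA]
    _ = ‖((A : ℂ) * S - W) + (W - V) + V‖ := by congr 1; ring
    _ ≤ N * √(2 * A) + N * (2 * ∑' n : ℕ, 1 / (n : ℝ) ^ 2) + N * D :=
        norm_add₃_le.trans (add_le_add_three hSW hWV hD)
    _ = _ := by ring

theorem eventually_sqrt_two_mul_add_le_mul (C : ℝ) {δ : ℝ} (hδ : 0 < δ) :
    ∀ᶠ A : ℝ in atTop, √(2 * A) + C ≤ δ * A := by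
  filter_upwards [eventually_gt_atTop 0, eventually_ge_atTop (8 / δ ^ 2),
    eventually_ge_atTop (2 * C / δ)] with A hA0 hA hAC
  have hsqrt : √(2 * A) ≤ δ / 2 * A := by
    rw [div_le_iff₀ (by positivity)] at hA
    refine Real.sqrt_le_iff.2 ⟨by positivity, ?_⟩
    nlinarith
  rw [div_le_iff₀ hδ] at hAC
  linarith

theorem tendsto_mean_mul_of_prime_correlations_of_norm_le_one (hF : ∀ n, ‖F n‖ ≤ 1)
    (hu : u.IsMultiplicative) (hu1 : ∀ n, ‖u n‖ ≤ 1)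
    (hcor : ∀ ε > 0, ∀ᶠ x in differentPrimesAtTop, ∀ᶠ M : ℕ in atTop,
      ‖∑ m ∈ Finset.Icc 1 M, F (x.1 * m) * starRingEnd ℂ (F (x.2 * m))‖ ≤ ε * M) :
    Tendsto (fun N : ℕ => (1 / (N : ℂ)) * ∑ n ∈ Finset.Icc 1 N, F n * u n) atTop (𝓝 0) := by
  rw [Metric.tendsto_nhds]
  intro δ hδ
  obtain ⟨P₀, hP₀⟩ := eventually_differentPrimesAtTop_iff.1 (hcor ((δ / 8) ^ 2) (by positivity))
  obtain ⟨J, hJ⟩ : ∃ J, P₀ ≤ 2 ^ J := ⟨P₀, Nat.lt_two_pow_self.le⟩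
  set C := 2 * ∑' n : ℕ, 1 / (n : ℝ) ^ 2 + ∑' j : ℕ, (√2)⁻¹ ^ j
  have hdiv := tendsto_sum_inv_dyadicPrimes J
  obtain ⟨K, hJK, hA0, hAC⟩ := ((eventually_ge_atTop J).and <| (hdiv.eventually_gt_atTop 0).and
    <| hdiv.eventually (eventually_sqrt_two_mul_add_le_mul C (show 0 < δ / 4 by positivity))).exists
  set P := dyadicPrimes J K
  set A := ∑ p ∈ P, (p : ℝ)⁻¹
  filter_upwards [eventually_norm_sum_dyadicPrimes_le (by positivity) hF hu1 hu1 hJK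
    fun p hp q hq => hP₀ p (hJ.trans hp) q (hJ.trans hq), eventually_ge_atTop (2 * P.card),
    eventually_gt_atTop 0] with N hN hcard hN0
  have hNpos : (0 : ℝ) < N := Nat.cast_pos.2 hN0
  have hle := sum_inv_mul_norm_sum_mul_le (P := P) hF hu hu1
    (fun p hp => (Finset.mem_filter.1 hp).2) hcard hN
  rw [Real.sqrt_sq (by positivity)] at hle
  rw [dist_zero_right, norm_mul, norm_div, norm_one, Complex.norm_natCast, one_div,
    inv_mul_lt_iff₀ hNpos]
  refine lt_of_mul_lt_mul_left (hle.trans_lt ?_) hA0.le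
  calc _ = N * (√(2 * A) + C + δ / 4 * A) := by
        simp only [A, P, C]
        ring
    _ ≤ N * (δ / 4 * A + δ / 4 * A) := by gcongr
    _ < A * (N * δ) := by linarith [show 0 < A * (N * δ) by positivity]

theorem tendsto_mean_mul_of_prime_correlations {C : ℝ} (hF : ∀ n, ‖F n‖ ≤ C)
    (hu : u.IsMultiplicative) (hu1 : ∀ n, ‖u n‖ ≤ 1)
    (hcor : ∀ ε > 0, ∀ᶠ x in differentPrimesAtTop, ∀ᶠ M : ℕ in atTop,
      ‖∑ m ∈ Finset.Icc 1 M, F (x.1 * m) * starRingEnd ℂ (F (x.2 * m))‖ ≤ ε * M) :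
    Tendsto (fun N : ℕ => (1 / (N : ℂ)) * ∑ n ∈ Finset.Icc 1 N, F n * u n) atTop (𝓝 0) := by
  obtain ⟨D, hD, hCD⟩ : ∃ D : ℝ, 0 < D ∧ C ≤ D := ⟨max C 1, by positivity, le_max_left _ _⟩
  have hD0 : (D : ℂ) ≠ 0 := Complex.ofReal_ne_zero.2 hD.ne'
  have hscaled := tendsto_mean_mul_of_prime_correlations_of_norm_le_one
    (F := fun n => (D : ℂ)⁻¹ * F n) (fun n => ?_) hu hu1 fun ε hε => ?_
  · refine (mul_zero (D : ℂ) ▸ hscaled.const_mul (D : ℂ)).congr fun N => ?_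
    rw [mul_left_comm, Finset.mul_sum]
    simp_rw [mul_assoc, mul_inv_cancel_left₀ hD0]
  · rw [norm_mul, norm_inv, Complex.norm_real, Real.norm_of_nonneg hD.le, inv_mul_le_one₀ hD]
    exact (hF n).trans hCD
  · filter_upwards [hcor (ε * D ^ 2) (by positivity)] with x hx
    filter_upwards [hx] with M hM
    have hfactor : ∑ m ∈ Finset.Icc 1 M,
        (D : ℂ)⁻¹ * F (x.1 * m) * starRingEnd ℂ ((D : ℂ)⁻¹ * F (x.2 * m)) =
        (((D ^ 2)⁻¹ : ℝ) : ℂ) *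
          ∑ m ∈ Finset.Icc 1 M, F (x.1 * m) * starRingEnd ℂ (F (x.2 * m)) := by
      rw [Finset.mul_sum]
      refine Finset.sum_congr rfl fun m _ => ?_
      rw [map_mul, map_inv₀, Complex.conj_ofReal]
      push_cast
      ring
    rw [hfactor, norm_mul, Complex.norm_real, Real.norm_of_nonneg (by positivity),
      inv_mul_le_iff₀ (by positivity)]
    linarith

end OrthogonalityCriterion

section InvariantMeasures

open scoped BoundedContinuousFunction

theorem exists_mem_extremePoints_isMaxOn {E : Type*} [AddCommGroup E] [Module ℝ E]
    [TopologicalSpace E] [T2Space E] [IsTopologicalAddGroup E] [ContinuousSMul ℝ E]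
    [LocallyConvexSpace ℝ E] {s : Set E} (hs : IsCompact s) (hne : s.Nonempty)
    (l : StrongDual ℝ E) : ∃ x ∈ s.extremePoints ℝ, IsMaxOn l s x := by
  have hexp : IsExposed ℝ s (l.toExposed s) := ContinuousLinearMap.toExposed.isExposed
  obtain ⟨x₀, hx₀, hmax⟩ := hs.exists_isMaxOn hne l.continuous.continuousOn
  obtain ⟨x, hx⟩ := (hexp.isCompact hs).extremePoints_nonempty ⟨x₀, hx₀, hmax⟩
  exact ⟨x, hexp.isExtreme.extremePoints_subset_extremePoints hx, hx.1.2⟩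

variable {Z : Type*} [TopologicalSpace Z] [MeasurableSpace Z]

/-- The invariant probability measures of `R`, as a subset of the space of probability measures
with the topology of convergence in distribution. -/
def invariantProbabilityMeasures (R : Z → Z) : Set (ProbabilityMeasure Z) :=
  {ρ | MeasurePreserving R (ρ : Measure Z) ρ}

/-- A probability measure seen as a functional on the bounded continuous functions. The target is
a locally convex space with the topology of pointwise convergence, which is where the extreme
points of a set of measures are taken. -/
noncomputable def testIntegrals (ρ : ProbabilityMeasure Z) : (Z →ᵇ ℝ) → ℝ :=
  fun g => ∫ z, g z ∂(ρ : Measure Z)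

/-- The empirical measure `(δ_z + δ_{R z} + ⋯ + δ_{R^N z}) / (N + 1)` of an orbit of `R`. Using
`N + 1` points makes it a probability measure for every `N`. -/
noncomputable def orbitMeasure (R : Z → Z) (z : Z) (N : ℕ) : ProbabilityMeasure Z :=
  ⟨((N + 1 : ℕ) : ℝ≥0∞)⁻¹ • ∑ k ∈ Finset.range (N + 1), Measure.dirac (R^[k] z), ⟨by
    simp [ENNReal.inv_mul_cancel (Nat.cast_add_one_ne_zero N) (by finiteness)]⟩⟩

variable {R : Z → Z} [BorelSpace Z]

theorem integral_orbitMeasure [T2Space Z] {E : Type*} [NormedAddCommGroup E]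
    [NormedSpace ℝ E] [CompleteSpace E] (g : Z →ᵇ E) (z : Z) (N : ℕ) :
    ∫ x, g x ∂(orbitMeasure R z N : Measure Z) = birkhoffAverage ℝ R g (N + 1) z := by
  simp only [orbitMeasure, ProbabilityMeasure.coe_mk]
  rw [integral_smul_measure, integral_finsetSum_measure fun _ _ => integrable_dirac (by simp),
    ENNReal.toReal_inv, ENNReal.toReal_natCast]
  simp only [integral_dirac, birkhoffAverage, birkhoffSum]

variable [HasOuterApproxClosed Z]

theorem measurePreserving_iff_forall_integral_comp_eq (hR : Continuous R) (ρ : Measure Z)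
    [IsFiniteMeasure ρ] :
    MeasurePreserving R ρ ρ ↔ ∀ g : Z →ᵇ ℝ, ∫ z, g (R z) ∂ρ = ∫ z, g z ∂ρ := by
  have hmap (g : Z →ᵇ ℝ) : ∫ z, g z ∂ρ.map R = ∫ z, g (R z) ∂ρ :=
    integral_map hR.measurable.aemeasurable g.continuous.aestronglyMeasurable
  refine ⟨fun h g => by rw [← hmap, h.map_eq], fun h => ⟨hR.measurable, ?_⟩⟩
  exact ext_of_forall_integral_eq_of_IsFiniteMeasure fun g => (hmap g).trans (h g)

theorem isClosed_invariantProbabilityMeasures (hR : Continuous R) :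
    IsClosed (invariantProbabilityMeasures R) := by
  simp_rw [invariantProbabilityMeasures, measurePreserving_iff_forall_integral_comp_eq hR,
    Set.ofPred_forall]
  exact isClosed_iInter fun g => isClosed_eq
    (ProbabilityMeasure.continuous_integral_boundedContinuousFunction (g.compContinuous ⟨R, hR⟩))
    (ProbabilityMeasure.continuous_integral_boundedContinuousFunction g)

theorem ergodic_of_testIntegrals_mem_extremePoints {ρ : ProbabilityMeasure Z}
    (hρ : ρ ∈ invariantProbabilityMeasures R)
    (hext : testIntegrals ρ ∈ (testIntegrals '' invariantProbabilityMeasures R).extremePoints ℝ) :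
    Ergodic R (ρ : Measure Z) := by
  refine .of_mem_extremePoints (mem_extremePoints_iff_left.2 ⟨⟨hρ, inferInstance⟩, ?_⟩)
  rintro m₁ ⟨hm₁, hp₁⟩ m₂ ⟨hm₂, hp₂⟩ ⟨a, b, ha, hb, hab, hcomb⟩
  have ha' : a ≠ ∞ := ne_top_of_le_ne_top ENNReal.one_ne_top (hab ▸ le_self_add)
  have hb' : b ≠ ∞ := ne_top_of_le_ne_top ENNReal.one_ne_top (hab ▸ le_add_self)
  have habr : a.toReal + b.toReal = 1 := by
    rw [← ENNReal.toReal_add ha' hb', hab, ENNReal.toReal_one]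
  have hsegment : a.toReal • testIntegrals ⟨m₁, hp₁⟩ + b.toReal • testIntegrals ⟨m₂, hp₂⟩ =
      testIntegrals ρ := by
    funext g
    simp only [testIntegrals, ← hcomb, Pi.add_apply, Pi.smul_apply, ProbabilityMeasure.coe_mk]
    rw [integral_add_measure ((g.integrable m₁).smul_measure ha')
      ((g.integrable m₂).smul_measure hb'), integral_smul_measure, integral_smul_measure]
  have heq := hext.2 ⟨⟨m₁, hp₁⟩, hm₁, rfl⟩ ⟨⟨m₂, hp₂⟩, hm₂, rfl⟩
    ⟨_, _, ENNReal.toReal_pos ha.ne' ha', ENNReal.toReal_pos hb.ne' hb', habr, hsegment⟩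
  exact ext_of_forall_integral_eq_of_IsFiniteMeasure (congrFun heq)

variable [T2Space Z]

theorem mem_invariantProbabilityMeasures_of_mapClusterPt (hR : Continuous R) {z : Z}
    {ρ : ProbabilityMeasure Z} (hρ : MapClusterPt ρ atTop (orbitMeasure R z)) :
    ρ ∈ invariantProbabilityMeasures R := by
  refine (measurePreserving_iff_forall_integral_comp_eq hR _).2 fun g => sub_eq_zero.1 ?_
  let gR : Z →ᵇ ℝ := g.compContinuous ⟨R, hR⟩
  let defect (m : ProbabilityMeasure Z) : ℝ :=
    ∫ x, gR x ∂(m : Measure Z) - ∫ x, g x ∂(m : Measure Z)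
  have hdefect : Continuous defect :=
    (ProbabilityMeasure.continuous_integral_boundedContinuousFunction gR).sub
      (ProbabilityMeasure.continuous_integral_boundedContinuousFunction g)
  have htendsto : Tendsto (defect ∘ orbitMeasure R z) atTop (𝓝 0) := by
    refine ((tendsto_birkhoffAverage_apply_sub_birkhoffAverage' ℝ g.isBounded_range R z).comp
      (tendsto_add_atTop_nat 1)).congr fun N => ?_
    simp only [defect, Function.comp_apply, integral_orbitMeasure, birkhoffAverage, birkhoffSum,
      ← Function.iterate_succ_apply, Function.iterate_succ_apply']
    rfl
  have hcluster : MapClusterPt (defect ρ) atTop (defect ∘ orbitMeasure R z) :=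
    hρ.continuousAt_comp hdefect.continuousAt
  exact eq_of_nhds_neBot (ClusterPt.mono hcluster htendsto).neBot

variable [CompactSpace Z]

theorem exists_ergodic_integral_le (hR : Continuous R) {ρ : ProbabilityMeasure Z}
    (hρ : ρ ∈ invariantProbabilityMeasures R) (h : Z →ᵇ ℝ) :
    ∃ ρ' : ProbabilityMeasure Z, Ergodic R (ρ' : Measure Z) ∧
      ∫ z, h z ∂(ρ : Measure Z) ≤ ∫ z, h z ∂(ρ' : Measure Z) := by
  have hcont : Continuous (testIntegrals (Z := Z)) :=
    continuous_pi ProbabilityMeasure.continuous_integral_boundedContinuousFunction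
  have hcompact := (isClosed_invariantProbabilityMeasures hR).isCompact.image hcont
  obtain ⟨_, hext, hmax⟩ := exists_mem_extremePoints_isMaxOn hcompact ⟨_, ρ, hρ, rfl⟩
    (ContinuousLinearMap.proj h)
  obtain ⟨ρ', hρ', rfl⟩ := hext.1
  exact ⟨ρ', ergodic_of_testIntegrals_mem_extremePoints hρ' hext, hmax ⟨ρ, hρ, rfl⟩⟩

variable {𝕜 : Type*} [RCLike 𝕜]

theorem exists_ergodic_norm_integral_le (hR : Continuous R) {ρ : ProbabilityMeasure Z}
    (hρ : ρ ∈ invariantProbabilityMeasures R) (F : Z →ᵇ 𝕜) :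
    ∃ ρ' : ProbabilityMeasure Z, Ergodic R (ρ' : Measure Z) ∧
      ‖∫ z, F z ∂(ρ : Measure Z)‖ ≤ ‖∫ z, F z ∂(ρ' : Measure Z)‖ := by
  obtain ⟨c, hc, hcF⟩ := RCLike.exists_norm_eq_mul_self (∫ z, F z ∂(ρ : Measure Z))
  let reF : Z →ᵇ ℝ := RCLike.reCLM.compLeftContinuousBounded Z (c • F)
  have hreF (m : ProbabilityMeasure Z) :
      ∫ z, reF z ∂(m : Measure Z) = RCLike.re (c * ∫ z, F z ∂(m : Measure Z)) := by
    rw [← integral_const_mul]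
    exact integral_re ((F.integrable (m : Measure Z)).const_mul c)
  obtain ⟨ρ', hρ', hle⟩ := exists_ergodic_integral_le hR hρ reF
  refine ⟨ρ', hρ', ?_⟩
  calc ‖∫ z, F z ∂(ρ : Measure Z)‖
      ≤ RCLike.re (c * ∫ z, F z ∂(ρ' : Measure Z)) := by
        rwa [hreF, hreF, ← hcF, RCLike.ofReal_re] at hle
    _ ≤ ‖c * ∫ z, F z ∂(ρ' : Measure Z)‖ := RCLike.re_le_norm _
    _ = ‖∫ z, F z ∂(ρ' : Measure Z)‖ := by rw [norm_mul, hc, one_mul]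

theorem eventually_norm_birkhoffAverage_lt (hR : Continuous R) (F : Z →ᵇ 𝕜) {ε δ : ℝ}
    (hε : ∀ ρ : ProbabilityMeasure Z, Ergodic R (ρ : Measure Z) →
      ‖∫ z, F z ∂(ρ : Measure Z)‖ ≤ ε) (hδ : ε < δ) (z : Z) :
    ∀ᶠ N : ℕ in atTop, ‖birkhoffAverage ℝ R F N z‖ < δ := by
  rw [← map_add_atTop_eq_nat 1, eventually_map]
  simp_rw [← integral_orbitMeasure]
  by_contra hfreq
  simp only [not_eventually, not_lt] at hfreq
  have hcont : Continuous fun m : ProbabilityMeasure Z => ‖∫ x, F x ∂(m : Measure Z)‖ :=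
    continuous_norm.comp <| continuous_iff_continuousAt.2 fun _ =>
      (ProbabilityMeasure.tendsto_iff_forall_integral_rclike_tendsto 𝕜).1 tendsto_id F
  obtain ⟨ρ, hδρ, hρ⟩ :=
    (isClosed_le continuous_const hcont).isCompact.exists_mapClusterPt_of_frequently hfreq
  obtain ⟨ρ', herg, hle⟩ := exists_ergodic_norm_integral_le hR
    (mem_invariantProbabilityMeasures_of_mapClusterPt hR hρ) F
  exact (hδ.trans_le (hδρ.trans hle)).not_ge (hε ρ' herg)

end InvariantMeasures

section Powers

variable {Y : Type*} [MeasurableSpace Y] {S : Y → Y} {ν ν' : Measure Y} {r : ℕ}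

theorem measurePreserving_sum_map_iterate (hS : Measurable S)
    (hν' : MeasurePreserving S^[r] ν' ν') :
    MeasurePreserving S (∑ i ∈ Finset.range r, ν'.map S^[i])
      (∑ i ∈ Finset.range r, ν'.map S^[i]) := by
  have hshift : (∑ i ∈ Finset.range r, ν'.map S^[i]).map S =
      ∑ i ∈ Finset.range r, ν'.map S^[i + 1] := by
    simp only [← Measure.mapₗ_apply_of_measurable hS, map_sum]
    refine Finset.sum_congr rfl fun i _ => ?_
    rw [Measure.mapₗ_apply_of_measurable hS, Measure.map_map hS (hS.iterate i),
      Function.iterate_succ']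
  refine ⟨hS, hshift.trans ?_⟩
  cases r with
  | zero => rfl
  | succ k =>
    rw [Finset.sum_range_succ, Finset.sum_range_succ', hν'.map_eq, Function.iterate_zero,
      Measure.map_id]

theorem IsUniquelyErgodic.eq_of_measurePreserving_iterate (hν : IsUniquelyErgodic S ν)
    (hr : 0 < r) (herg : Ergodic S^[r] ν) [IsProbabilityMeasure ν']
    (hν' : MeasurePreserving S^[r] ν' ν') : ν' = ν := by
  have hS : Measurable S := hν.2.1.measurable
  have : IsProbabilityMeasure ν := hν.1
  set total : Measure Y := ∑ i ∈ Finset.range r, ν'.map S^[i] with htotal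
  have hprob : IsProbabilityMeasure ((r : ℝ≥0∞)⁻¹ • total) := by
    have hmass (i : ℕ) : ν'.map S^[i] Set.univ = 1 :=
      (Measure.isProbabilityMeasure_map (hS.iterate i).aemeasurable).measure_univ
    constructor
    simp [htotal, hmass, ENNReal.inv_mul_cancel (Nat.cast_ne_zero.2 hr.ne')]
  have haverage : (r : ℝ≥0∞)⁻¹ • total = ν :=
    hν.2.2 _ hprob ((measurePreserving_sum_map_iterate hS hν').smul_measure _)
  have hle : ν' ≤ total := by
    simpa using Finset.single_le_sum (f := fun i => ν'.map S^[i]) (fun _ _ => Measure.zero_le _)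
      (Finset.mem_range.2 hr)
  have hac : total ≪ ν := by
    rw [← haverage]
    exact Measure.absolutelyContinuous_smul (by simp)
  exact herg.eq_of_absolutelyContinuous hν' (hle.absolutelyContinuous.trans hac)

end Powers

section Factors

theorem ae_semiconj_iterate {α β : Type*} [MeasurableSpace α] {μ : Measure α} {f : α → α}
    {g : β → β} {π : α → β} (hf : MeasurePreserving f μ μ)
    (h : ∀ᵐ x ∂μ, π (f x) = g (π x)) (n : ℕ) : ∀ᵐ x ∂μ, π (f^[n] x) = g^[n] (π x) := by
  induction n with
  | zero => simp
  | succ n ih =>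
    filter_upwards [h, hf.quasiMeasurePreserving.ae ih] with x hx hfx
    rw [Function.iterate_succ_apply, hfx, hx, Function.iterate_succ_apply]

variable {α β : Type*} [MeasurableSpace α] [MeasurableSpace β] {μ : Measure α} {ν : Measure β}
  {f : α → α} {g : β → β} {π : α → β} {ψ : β → α}

theorem ae_semiconj_inverse (hψ : MeasurePreserving ψ ν μ) (hf : MeasurePreserving f μ μ)
    (h : ∀ᵐ x ∂μ, π (f x) = g (π x)) (hψπ : ∀ᵐ x ∂μ, ψ (π x) = x)
    (hπψ : ∀ᵐ y ∂ν, π (ψ y) = y) : ∀ᵐ y ∂ν, ψ (g y) = f (ψ y) := by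
  filter_upwards [hψ.quasiMeasurePreserving.ae h,
    (hf.comp hψ).quasiMeasurePreserving.ae hψπ, hπψ] with y hsemiconj hleft hright
  rwa [Function.comp_apply, hsemiconj, hright] at hleft

theorem ergodic_of_ae_semiconj (hπ : MeasurePreserving π μ ν) (hf : Ergodic f μ)
    (hg : Measurable g) (h : ∀ᵐ x ∂μ, π (f x) = g (π x)) : Ergodic g ν := by
  have hmap : ν.map g = ν := by
    calc ν.map g = μ.map (g ∘ π) := by rw [← hπ.map_eq, Measure.map_map hg hπ.measurable]
      _ = μ.map (π ∘ f) := Measure.map_congr (h.mono fun x hx => hx.symm)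
      _ = ν := (hπ.comp hf.toMeasurePreserving).map_eq
  refine ⟨⟨hg, hmap⟩, ⟨fun s hs hgs => ?_⟩⟩
  rw [← hπ.aeconst_preimage hs.nullMeasurableSet]
  have hinv : f ⁻¹' (π ⁻¹' s) =ᵐ[μ] π ⁻¹' s := by
    refine eventuallyEq_set.2 (h.mono fun x hx => ?_)
    rw [Set.mem_preimage, Set.mem_preimage, hx, ← Set.mem_preimage, hgs, Set.mem_preimage]
  exact hf.quasiErgodic.aeconst_set₀ (hπ.measurable hs).nullMeasurableSet hinv

theorem map_prodMap_mem_ergodicJoinings {f₁ f₂ : α → α} {g₁ g₂ : β → β}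
    (hπ : MeasurePreserving π μ ν) (hg₁ : Measurable g₁) (hg₂ : Measurable g₂)
    (h₁ : ∀ᵐ x ∂μ, π (f₁ x) = g₁ (π x)) (h₂ : ∀ᵐ x ∂μ, π (f₂ x) = g₂ (π x))
    {κ : Measure (α × α)} (hκ : κ ∈ ergodicJoinings f₁ f₂ μ) :
    κ.map (Prod.map π π) ∈ ergodicJoinings g₁ g₂ ν := by
  obtain ⟨hfst, hsnd, herg⟩ := hκ
  have hππ : MeasurePreserving (Prod.map π π) κ (κ.map (Prod.map π π)) :=
    (hπ.measurable.prodMap hπ.measurable).measurePreserving κ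
  have hfst' : MeasurePreserving Prod.fst κ μ := ⟨measurable_fst, hfst⟩
  have hsnd' : MeasurePreserving Prod.snd κ μ := ⟨measurable_snd, hsnd⟩
  refine ⟨?_, ?_, ergodic_of_ae_semiconj hππ herg (hg₁.prodMap hg₂) ?_⟩
  · rw [Measure.map_map measurable_fst hππ.measurable]
    exact (hπ.comp hfst').map_eq
  · rw [Measure.map_map measurable_snd hππ.measurable]
    exact (hπ.comp hsnd').map_eq
  · filter_upwards [hfst'.quasiMeasurePreserving.ae h₁,
      hsnd'.quasiMeasurePreserving.ae h₂] with z hz₁ hz₂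
    exact Prod.ext hz₁ hz₂

end Factors

section Isomorphism

variable {X Y : Type*} [MeasurableSpace X] [MeasurableSpace Y] {T : X → X} {S : Y → Y}
  {μ : Measure X} {ν : Measure Y}

theorem IsTotallyErgodic.of_areIsomorphic (hT : IsTotallyErgodic T μ) (hS : Measurable S)
    (hiso : AreIsomorphic T μ S ν) : IsTotallyErgodic S ν := by
  obtain ⟨φ, ⟨hφ, -⟩, hconj⟩ := hiso
  exact fun m hm => ergodic_of_ae_semiconj hφ (hT m hm) (hS.iterate m)
    (ae_semiconj_iterate (hT 1 one_pos).toMeasurePreserving hconj m)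

theorem HasAOP.of_areIsomorphic (hAOP : HasAOP T μ) (hT : MeasurePreserving T μ μ)
    (hS : MeasurePreserving S ν ν) (hiso : AreIsomorphic T μ S ν) : HasAOP S ν := by
  obtain ⟨φ, ⟨hφ, ψ, hψ, hψφ, hφψ⟩, hconj⟩ := hiso
  have hψS : ∀ᵐ y ∂ν, ψ (S y) = T (ψ y) := ae_semiconj_inverse hψ hT hconj hψφ hφψ
  intro f g hf hg hf0 hg0
  have hfφ := hf.comp_measurePreserving hφ
  have hgφ := hg.comp_measurePreserving hφ
  have hmean {h : Y → ℂ} (hh : MemLp h 2 ν) (h0 : ∫ y, h y ∂ν = 0) : ∫ x, h (φ x) ∂μ = 0 := by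
    rw [← h0, ← hφ.map_eq, integral_map hφ.measurable.aemeasurable]
    exact hφ.map_eq ▸ hh.aestronglyMeasurable
  have hlim := hAOP (f ∘ φ) (g ∘ φ) hfφ hgφ (hmean hf hf0) (hmean hg hg0)
  refine tendsto_of_tendsto_of_tendsto_of_le_of_le tendsto_const_nhds hlim (fun _ => zero_le)
    fun p => iSup₂_le fun κ hκ => ?_
  have hκψ : κ.map (Prod.map ψ ψ) ∈ ergodicJoinings T^[p.1] T^[p.2] μ :=
    map_prodMap_mem_ergodicJoinings hψ (hT.measurable.iterate _) (hT.measurable.iterate _)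
      (ae_semiconj_iterate hS hψS _) (ae_semiconj_iterate hS hψS _) hκ
  refine le_iSup₂_of_le _ hκψ (le_of_eq ?_)
  have hfst : MeasurePreserving Prod.fst κ ν := ⟨measurable_fst, hκ.1⟩
  have hsnd : MeasurePreserving Prod.snd κ ν := ⟨measurable_snd, hκ.2.1⟩
  rw [integral_map (hψ.measurable.prodMap hψ.measurable).aemeasurable]
  · congr 1
    refine integral_congr_ae ?_
    filter_upwards [hfst.quasiMeasurePreserving.ae hφψ,
      hsnd.quasiMeasurePreserving.ae hφψ] with z hz₁ hz₂
    simp only [Function.comp_apply, Prod.map_fst, Prod.map_snd, hz₁, hz₂]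
  · exact (hfφ.aestronglyMeasurable.comp_measurePreserving ⟨measurable_fst, hκψ.1⟩).mul
      (hgφ.aestronglyMeasurable.comp_measurePreserving ⟨measurable_snd, hκψ.2.1⟩)

end Isomorphism

section Correlations

theorem HasAOP.eventually_forall_norm_integral_le {X : Type*} [MeasurableSpace X] {T : X → X}
    {μ : Measure X} (hAOP : HasAOP T μ) {f g : X → ℂ} (hf : MemLp f 2 μ) (hg : MemLp g 2 μ)
    (hf0 : ∫ x, f x ∂μ = 0) (hg0 : ∫ x, g x ∂μ = 0) {ε : ℝ} (hε : 0 < ε) :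
    ∀ᶠ p in differentPrimesAtTop, ∀ κ ∈ ergodicJoinings T^[p.1] T^[p.2] μ,
      ‖∫ z : X × X, f z.1 * g z.2 ∂κ‖ ≤ ε := by
  filter_upwards [(hAOP f g hf hg hf0 hg0).eventually_lt_const (ENNReal.ofReal_pos.2 hε)]
    with p hp κ hκ
  rw [← ENNReal.ofReal_le_ofReal_iff hε.le, ofReal_norm]
  exact (le_iSup₂ (f := fun κ _ => ‖∫ z : X × X, f z.1 * g z.2 ∂κ‖ₑ) κ hκ).trans hp.le

variable {Y : Type*} [MeasurableSpace Y] {S : Y → Y} {ν : Measure Y}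

theorem IsUniquelyErgodic.mem_ergodicJoinings (hν : IsUniquelyErgodic S ν)
    (hS : IsTotallyErgodic S ν) {r s : ℕ} (hr : 0 < r) (hs : 0 < s) {κ : Measure (Y × Y)}
    [IsProbabilityMeasure κ] (hκ : Ergodic (Prod.map S^[r] S^[s]) κ) :
    κ ∈ ergodicJoinings S^[r] S^[s] ν := by
  have hSm : Measurable S := hν.2.1.measurable
  have := Measure.isProbabilityMeasure_map (μ := κ) measurable_fst.aemeasurable
  have := Measure.isProbabilityMeasure_map (μ := κ) measurable_snd.aemeasurable
  refine ⟨hν.eq_of_measurePreserving_iterate hr (hS r hr) ?_,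
    hν.eq_of_measurePreserving_iterate hs (hS s hs) ?_, hκ⟩
  · exact (measurable_fst.measurePreserving κ).of_semiconj hκ.toMeasurePreserving
      (fun _ => rfl) (hSm.iterate r)
  · exact (measurable_snd.measurePreserving κ).of_semiconj hκ.toMeasurePreserving
      (fun _ => rfl) (hSm.iterate s)

end Correlations

section UniquelyErgodicModels

theorem birkhoffSum_apply_eq_sum_Icc {α M : Type*} [AddCommMonoid M] (R : α → α) (g : α → M)
    (N : ℕ) (z : α) : birkhoffSum R g N (R z) = ∑ n ∈ Finset.Icc 1 N, g (R^[n] z) := by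
  simp only [birkhoffSum, ← Function.iterate_succ_apply, Nat.succ_eq_add_one]
  rw [Finset.range_eq_Ico, Finset.sum_Ico_add' fun n => g (R^[n] z)]
  rfl

variable {Y : Type*} [MetricSpace Y] [CompactSpace Y] [MeasurableSpace Y] [BorelSpace Y]
  {S : Y → Y} {ν : Measure Y}

theorem HasAOP.eventually_norm_sum_mul_le (hAOP : HasAOP S ν) (herg : IsTotallyErgodic S ν)
    (hS : Continuous S) (hν : IsUniquelyErgodic S ν) (f g : C(Y, ℂ)) (hf : ∫ y, f y ∂ν = 0)
    (hg : ∫ y, g y ∂ν = 0) (y z : Y) {ε : ℝ} (hε : 0 < ε) :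
    ∀ᶠ x in differentPrimesAtTop, ∀ᶠ M : ℕ in atTop,
      ‖∑ m ∈ Finset.Icc 1 M, f (S^[x.1 * m] y) * g (S^[x.2 * m] z)‖ ≤ ε * M := by
  have : IsProbabilityMeasure ν := hν.1
  have hL2 (h : C(Y, ℂ)) : MemLp h 2 ν :=
    .of_bound h.continuous.aestronglyMeasurable ‖h‖ (.of_forall h.norm_coe_le_norm)
  have hprimes : ∀ᶠ x : ℕ × ℕ in differentPrimesAtTop, x.1.Prime ∧ x.2.Prime ∧ x.1 ≠ x.2 :=
    mem_inf_of_right (mem_principal_self _)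
  filter_upwards [hprimes,
    hAOP.eventually_forall_norm_integral_le (hL2 f) (hL2 g) hf hg (half_pos hε)]
    with ⟨r, s⟩ ⟨hr, hs, _⟩ hjoin
  let R : Y × Y → Y × Y := Prod.map S^[r] S^[s]
  let F : BoundedContinuousFunction (Y × Y) ℂ :=
    .mkOfCompact (f.comp .fst * g.comp .snd)
  have hbirkhoff := eventually_norm_birkhoffAverage_lt
    ((hS.iterate r).prodMap (hS.iterate s)) F
    (fun ρ hρ => hjoin ρ (hν.mem_ergodicJoinings herg hr.pos hs.pos hρ))
    (half_lt_self hε) (R (y, z))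
  filter_upwards [hbirkhoff, eventually_gt_atTop 0] with M hM hMpos
  have hMpos' : (0 : ℝ) < M := Nat.cast_pos.2 hMpos
  rw [birkhoffAverage, birkhoffSum_apply_eq_sum_Icc, norm_smul, norm_inv, Real.norm_natCast,
    inv_mul_lt_iff₀ hMpos', mul_comm] at hM
  simpa [F, R, Prod.map_iterate, ← Function.iterate_mul] using hM.le

theorem HasAOP.tendsto_mean_mul (hAOP : HasAOP S ν) (herg : IsTotallyErgodic S ν)
    (hS : Continuous S) (hν : IsUniquelyErgodic S ν) {u : ArithmeticFunction ℂ}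
    (hu : u.IsMultiplicative) (hu1 : ∀ n, ‖u n‖ ≤ 1) (f : C(Y, ℂ)) (hf : ∫ y, f y ∂ν = 0)
    (y : Y) :
    Tendsto (fun N : ℕ => (1 / (N : ℂ)) * ∑ n ∈ Finset.Icc 1 N, f (S^[n] y) * u n)
      atTop (𝓝 0) := by
  have hconj : ∫ y, (star f) y ∂ν = 0 :=
    integral_conj.trans (by rw [hf, map_zero])
  exact tendsto_mean_mul_of_prime_correlations (fun n => f.norm_coe_le_norm (S^[n] y)) hu hu1
    fun ε hε => hAOP.eventually_norm_sum_mul_le herg hS hν f (star f) hf hconj y y hε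

end UniquelyErgodicModels

theorem isMoebiusDisjoint_of_tendsto_of_integral_eq_zero {Y : Type*} [TopologicalSpace Y]
    [CompactSpace Y] [MeasurableSpace Y] [OpensMeasurableSpace Y] {S : Y → Y} (ν : Measure Y)
    [IsProbabilityMeasure ν]
    (h : ∀ f : C(Y, ℂ), ∫ y, f y ∂ν = 0 → ∀ y : Y,
      Tendsto (fun N : ℕ => (1 / (N : ℂ)) *
        ∑ n ∈ Finset.Icc 1 N, f (S^[n] y) * ((ArithmeticFunction.moebius n : ℤ) : ℂ))
        atTop (𝓝 0)) : IsMoebiusDisjoint S := by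
  intro f y
  set c : ℂ := ∫ y, f y ∂ν
  have hmean : ∫ y, (f - ContinuousMap.const Y c) y ∂ν = 0 := by
    have hf : Integrable f ν := (BoundedContinuousFunction.mkOfCompact f).integrable ν
    simp only [ContinuousMap.sub_apply, ContinuousMap.const_apply]
    rw [integral_sub hf (integrable_const c), integral_const, probReal_univ, one_smul, sub_self]
  have hsum := (h _ hmean y).add (tendsto_mean_moebius.const_mul c)
  rw [mul_zero, add_zero] at hsum
  refine hsum.congr fun N => ?_
  rw [mul_left_comm c, ← mul_add, Finset.mul_sum, ← Finset.sum_add_distrib]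
  simp only [ContinuousMap.sub_apply, ContinuousMap.const_apply, ← add_mul, sub_add_cancel]

theorem theorem2_general {X : Type*} [MeasurableSpace X] {μ : Measure X} {T : X → X}
    (hTerg : IsTotallyErgodic T μ) (hAOP : HasAOP T μ)
    {Y : Type*} [MetricSpace Y] [CompactSpace Y] [MeasurableSpace Y] [BorelSpace Y]
    {S : Y → Y} (hS : Continuous S) {ν : Measure Y} (hν : IsUniquelyErgodic S ν)
    (hiso : AreIsomorphic T μ S ν) :
    (∀ u : ArithmeticFunction ℂ, u.IsMultiplicative → (∀ n, ‖u n‖ ≤ 1) →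
      ∀ f : C(Y, ℂ), ∫ y, f y ∂ν = 0 → ∀ y : Y,
        Tendsto (fun N : ℕ => (1 / (N : ℂ)) * ∑ n ∈ Finset.Icc 1 N, f (S^[n] y) * u n)
          atTop (𝓝 0)) ∧
    IsMoebiusDisjoint S := by
  have : IsProbabilityMeasure ν := hν.1
  have hSerg : IsTotallyErgodic S ν := hTerg.of_areIsomorphic hS.measurable hiso
  have hSAOP : HasAOP S ν :=
    hAOP.of_areIsomorphic (hTerg 1 one_pos).toMeasurePreserving hν.2.1 hiso
  have hmean (u : ArithmeticFunction ℂ) (hu : u.IsMultiplicative) (hu1 : ∀ n, ‖u n‖ ≤ 1)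
      (f : C(Y, ℂ)) (hf : ∫ y, f y ∂ν = 0) (y : Y) :=
    hSAOP.tendsto_mean_mul hSerg hS hν hu hu1 f hf y
  have hmoebius (n : ℕ) : ‖(ArithmeticFunction.moebius : ArithmeticFunction ℂ) n‖ ≤ 1 := by
    rw [ArithmeticFunction.intCoe_apply, Complex.norm_intCast]
    exact_mod_cast ArithmeticFunction.abs_moebius_le_one
  refine ⟨hmean, isMoebiusDisjoint_of_tendsto_of_integral_eq_zero ν fun f hf y => ?_⟩
  simpa only [ArithmeticFunction.intCoe_apply] using
    hmean _ ArithmeticFunction.isMultiplicative_moebius.intCast hmoebius f hf y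

theorem theorem2 {X : Type*} [MeasurableSpace X] [StandardBorelSpace X]
    (μ : Measure X) [IsProbabilityMeasure μ] (T : X → X)
    (hT : IsAutomorphism T μ) (hTerg : IsTotallyErgodic T μ) (hAOP : HasAOP T μ)
    {Y : Type*} [MetricSpace Y] [CompactSpace Y] [MeasurableSpace Y] [BorelSpace Y]
    (S : Y → Y) (hS : Continuous S) (ν : Measure Y) (hν : IsUniquelyErgodic S ν)
    (hiso : AreIsomorphic T μ S ν) :
    (∀ u : ArithmeticFunction ℂ, u.IsMultiplicative → (∀ n, ‖u n‖ ≤ 1) →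
      ∀ f : C(Y, ℂ), ∫ y, f y ∂ν = 0 → ∀ y : Y,
        Tendsto (fun N : ℕ => (1 / (N : ℂ)) * ∑ n ∈ Finset.Icc 1 N, f (S^[n] y) * u n)
          atTop (𝓝 0)) ∧
    IsMoebiusDisjoint S :=
  theorem2_general hTerg hAOP hS hν hiso
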